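/- Let $H(3;\mathbb C)$ be the complex Heisenberg group of upper unitriangular $3\times3$ matrices, with coordinates $z_1$ (entry $12$), $z_2$ (entry $23$), $z_3$ (entry $13$), let $\Gamma=H(3;\mathbb Z[i])$, and let $\mathbb I_3=\Gamma\backslash H(3;\mathbb C)$ be the Iwasawa manifold. For $t=(t_{11},t_{12},t_{21},t_{22},t_{31},t_{32})\in\mathbb C^6$ put $D(t)=t_{11}t_{22}-t_{12}t_{21}$ and $$\zeta_1^t=z_1+\sum_{j=1}^2 t_{1j}\bar z_j,\qquad \zeta_2^t=z_2+\sum_{j=1}^2 t_{2j}\bar z_j,$$ $$\zeta_3^t=z_3+\sum_{j=1}^2(t_{3j}+t_{2j}z_1)\bar z_j+\tfrac12\left(t_{11}t_{21}\bar z_1^2+2t_{11}t_{22}\bar z_1\bar z_2+t_{12}t_{22}\bar z_2^2\right)-D(t)\bar z_3 .$$ Let $U\subset\mathbb C^6$ be the set of all $t$ for which the Jacobian of $\zeta^t=(\zeta_1^t,\zeta_2^t,\zeta_3^t)$ does not vanish, i.e. $$1+|D(t)|^2-\left(|t_{11}|^2+|t_{22}|^2+t_{12}\overline{t_{21}}+\overline{t_{12}}\,t_{21}\right)\neq0\quad\text{and}\quad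 |D(t)|\neq1 .$$ For $t\in U$ let $M_t$ be the quotient $\Gamma\backslash H(3;\mathbb C)$ with the complex structure for which $\zeta^t$ gives local holomorphic coordinates (Nakamura's family). A Hermitian metric is SKT if its fundamental form $\omega$ satisfies $\partial\bar\partial\omega=0$. Then: 1. $U$ is open, and the $M_t$, $t\in U$, are the fibres of a holomorphic family of compact complex manifolds over $U$ (a proper holomorphic submersion of a complex manifold onto $U$); $0\in U$, and $M_0$ is biholomorphic to $\mathbb I_3$. 2. There is $\varepsilon>0$ such that every $t\in\mathbb C^6$ with $\max_{i,j}|t_{ij}|<\varepsilon$ lies in $U$, and $M_t$ admits no SKT metric (left-invariant or not). 3. Let $S=\{t\in\mathbb C^6: t_{11}=t_{22}=0,\ t_{12}=-t_{21}\}$. If $t\in S$ and $|t_{21}|^2=2-\sqrt3$, then $t\in U$, the segment $\{rt:0\le r\le1\}$ lies in $S\cap U$ (so that it connects the standard complex structure $M_0$ to $M_t$ through members of the sub-family), and $M_t$ admits an SKT metric. In particular (with $t_{31}=t_{32}=0$) the sub-family connects the standard complex structure to a circle of complex structures admitting SKT metrics. 4. If $t\in S$ and $|t_{21}|^2=2+\sqrt3$,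 then $t\in U$ and $M_t$ admits an SKT metric. In particular (with $t_{31}=t_{32}=0$) this gives another circle of complex structures admitting SKT metrics. -/

import Mathlib

open scoped ComplexConjugate ContDiff Manifold Topology

noncomputable section

/-! ### Forms, `∂`, `∂̄` and SKT metrics on complex manifolds -/

section SKT

variable {E : Type*} [NormedAddCommGroup E] [NormedSpace ℂ E]

/-- A complex valued real-multilinear alternating `k`-form on the complex vector space `E` has
type `(p, q)` if it is homogeneous of bidegree `(p, q)` for complex scalars, i.e. if it lies in
`Λ^{p,q} E^*` (the components of the other types have other bidegrees). -/
def IsOfType {k : ℕ} (p q : ℕ) (α : E [⋀^Fin k]→L[ℝ] ℂ) : Prop :=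
  ∀ (c : ℂ) (v : Fin k → E), α (fun i => c • v i) = c ^ p * conj c ^ q * α v

/-- `β = ∂ α` on the open set `U`, where `α` is a form of type `(p, q)`: `β` is the component of
type `(p + 1, q)` of `dα`, whose other component has type `(p, q + 1)`. -/
def IsDel {k : ℕ} (p q : ℕ) (U : Set E) (α : E → E [⋀^Fin k]→L[ℝ] ℂ)
    (β : E → E [⋀^Fin (k + 1)]→L[ℝ] ℂ) : Prop :=
  ∀ y ∈ U, IsOfType (p + 1) q (β y) ∧ IsOfType p (q + 1) (extDeriv α y - β y)

/-- `β = ∂̄ α` on the open set `U`, where `α` is a form of type `(p, q)`: `β` is the component of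
type `(p, q + 1)` of `dα`, whose other component has type `(p + 1, q)`. -/
def IsDelbar {k : ℕ} (p q : ℕ) (U : Set E) (α : E → E [⋀^Fin k]→L[ℝ] ℂ)
    (β : E → E [⋀^Fin (k + 1)]→L[ℝ] ℂ) : Prop :=
  ∀ y ∈ U, IsOfType p (q + 1) (β y) ∧ IsOfType (p + 1) q (extDeriv α y - β y)

/-- `∂ ∂̄ α = 0` on the open set `U`, for a form `α` of type `(1, 1)`. -/
def DelDelbarEqZeroOn (U : Set E) (α : E → E [⋀^Fin 2]→L[ℝ] ℂ) : Prop :=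
  ∃ β : E → E [⋀^Fin 3]→L[ℝ] ℂ, IsDelbar 1 1 U α β ∧ IsDel 1 2 U β 0

/-- The form `ω(v, w) = g(i v, w)` of a bilinear form `g` on `E` (made alternating, which changes
nothing if `g` is symmetric and invariant under multiplication by `i`, see
`fundamentalForm_apply`). -/
def fundamentalForm (g : E →L[ℝ] E →L[ℝ] ℝ) : E [⋀^Fin 2]→L[ℝ] ℂ where
  toFun v := (((g (Complex.I • v 0) (v 1) - g (Complex.I • v 1) (v 0)) / 2 : ℝ) : ℂ)
  map_update_add' := by
    intro _ v i x y
    rw [← Complex.ofReal_add, Complex.ofReal_inj]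
    fin_cases i <;> simp [Function.update] <;> ring
  map_update_smul' := by
    intro _ v i c x
    rw [Complex.real_smul, ← Complex.ofReal_mul, Complex.ofReal_inj]
    fin_cases i <;> simp [Function.update, smul_comm Complex.I c] <;> ring
  map_eq_zero_of_eq' := by
    intro v i j h hij
    have h01 : v 0 = v 1 := by
      fin_cases i <;> fin_cases j <;> simp_all
    simp [h01]
  cont := by
    refine Complex.continuous_ofReal.comp ?_
    fun_prop

theorem fundamentalForm_apply (g : E →L[ℝ] E →L[ℝ] ℝ) (hs : ∀ v w, g v w = g w v)
    (hJ : ∀ v w, g (Complex.I • v) (Complex.I • w) = g v w) (v w : E) :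
    fundamentalForm g ![v, w] = (g (Complex.I • v) w : ℂ) := by
  have h : g (Complex.I • w) v = -g (Complex.I • v) w := by
    rw [hs, ← hJ v (Complex.I • w), smul_smul]
    simp
  change (((g (Complex.I • v) w - g (Complex.I • w) v) / 2 : ℝ) : ℂ) = _
  rw [h]
  congr 1
  ring

variable (E) in
/-- A smooth Hermitian metric on a complex manifold `M` modelled on `E`: a smooth Riemannian metric
`g` which is invariant under the complex structure. It is given by its local expression in
each holomorphic chart `e` of the atlas (a function on `e.target`), and the local expressions are
related by the transformation rule of tensors. -/
structure HermitianMetric (M : Type*) [TopologicalSpace M] [ChartedSpace E M] where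
  /-- The local expression of the metric in a chart. -/
  inChart : OpenPartialHomeomorph M E → E → (E →L[ℝ] E →L[ℝ] ℝ)
  smooth : ∀ e ∈ atlas E M, ContDiffOn ℝ ∞ (inChart e) e.target
  symm : ∀ e ∈ atlas E M, ∀ y ∈ e.target, ∀ v w, inChart e y v w = inChart e y w v
  pos : ∀ e ∈ atlas E M, ∀ y ∈ e.target, ∀ v, v ≠ 0 → 0 < inChart e y v v
  invariant : ∀ e ∈ atlas E M, ∀ y ∈ e.target, ∀ v w,
    inChart e y (Complex.I • v) (Complex.I • w) = inChart e y v w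
  transform : ∀ e ∈ atlas E M, ∀ e' ∈ atlas E M, ∀ y ∈ (e.symm.trans e').source, ∀ v w,
    inChart e y v w = inChart e' ((e.symm.trans e') y)
      (fderiv ℝ (e.symm.trans e') y v) (fderiv ℝ (e.symm.trans e') y w)

variable (E) in
/-- The complex manifold `M` admits an SKT (strong Kähler with torsion, pluriclosed) metric:
a Hermitian metric whose fundamental form `ω = g(J·, ·)` satisfies `∂ ∂̄ ω = 0`. -/
def AdmitsSKT (M : Type*) [TopologicalSpace M] [ChartedSpace E M] : Prop :=
  ∃ g : HermitianMetric E M, ∀ e ∈ atlas E M,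
    DelDelbarEqZeroOn e.target (fun y => fundamentalForm (g.inChart e y))

end SKT

/-! ### Holomorphic families of compact complex manifolds -/

/-- The `M t`, `t ∈ B`, are the fibres of a holomorphic family of compact complex manifolds over the
open set `B`: they are compact complex manifolds, and there are a complex manifold `X`
and a proper holomorphic submersion `f` from `X` onto `B` such that each `M t` is embedded in
`X` as a complex submanifold with image `f ⁻¹ {t}`. -/
def IsHolomorphicFamily (E : Type) [NormedAddCommGroup E] [NormedSpace ℂ E]
    {P : Type} [NormedAddCommGroup P] [NormedSpace ℂ P] (B : Set P) (M : B → Type)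
    [∀ t, TopologicalSpace (M t)] [∀ t, ChartedSpace E (M t)] : Prop :=
  IsOpen B ∧
  (∀ t, CompactSpace (M t) ∧ T2Space (M t) ∧ IsManifold 𝓘(ℂ, E) ω (M t)) ∧
  ∃ (X : Type) (_ : TopologicalSpace X) (_ : ChartedSpace (E × P) X) (f : X → P),
    T2Space X ∧ SecondCountableTopology X ∧ IsManifold 𝓘(ℂ, E × P) ω X ∧
    ContMDiff 𝓘(ℂ, E × P) 𝓘(ℂ, P) ω f ∧
    Set.range f = B ∧
    (∀ K ⊆ B, IsCompact K → IsCompact (f ⁻¹' K)) ∧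
    (∀ x, Function.Surjective (mfderiv 𝓘(ℂ, E × P) 𝓘(ℂ, P) f x)) ∧
    ∀ t : B, ∃ j : M t → X,
      ContMDiff 𝓘(ℂ, E) 𝓘(ℂ, E × P) ω j ∧ Function.Injective j ∧
      (∀ x, Function.Injective (mfderiv 𝓘(ℂ, E) 𝓘(ℂ, E × P) j x)) ∧
      Set.range j = f ⁻¹' {(t : P)}

/-! ### The Heisenberg group and its lattice of Gaussian integers -/

/-- The complex Heisenberg group `H(3; ℂ)`, in the coordinates `(z₁, z₂, z₃) = (z 0, z 1, z 2)`;
see `Heis.toMatrix`. -/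
def Heis : Type := Fin 3 → ℂ

namespace Heis

instance : TopologicalSpace Heis := inferInstanceAs (TopologicalSpace (Fin 3 → ℂ))
instance : T2Space Heis := inferInstanceAs (T2Space (Fin 3 → ℂ))
instance : LocallyCompactSpace Heis := inferInstanceAs (LocallyCompactSpace (Fin 3 → ℂ))
instance : ChartedSpace (Fin 3 → ℂ) Heis :=
  inferInstanceAs (ChartedSpace (Fin 3 → ℂ) (Fin 3 → ℂ))

@[ext] theorem ext {a b : Heis} (h0 : a 0 = b 0) (h1 : a 1 = b 1) (h2 : a 2 = b 2) : a = b := by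
  funext i
  fin_cases i <;> assumption

instance : Mul Heis := ⟨fun a b => ![a 0 + b 0, a 1 + b 1, a 2 + b 2 + a 0 * b 1]⟩
instance : One Heis := ⟨![0, 0, 0]⟩
instance : Inv Heis := ⟨fun a => ![-a 0, -a 1, -a 2 + a 0 * a 1]⟩

@[simp] theorem mul_zero' (a b : Heis) : (a * b) 0 = a 0 + b 0 := rfl
@[simp] theorem mul_one' (a b : Heis) : (a * b) 1 = a 1 + b 1 := rfl
@[simp] theorem mul_two' (a b : Heis) : (a * b) 2 = a 2 + b 2 + a 0 * b 1 := rfl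
@[simp] theorem one_zero' : (1 : Heis) 0 = 0 := rfl
@[simp] theorem one_one' : (1 : Heis) 1 = 0 := rfl
@[simp] theorem one_two' : (1 : Heis) 2 = 0 := rfl
@[simp] theorem inv_zero' (a : Heis) : a⁻¹ 0 = -a 0 := rfl
@[simp] theorem inv_one' (a : Heis) : a⁻¹ 1 = -a 1 := rfl
@[simp] theorem inv_two' (a : Heis) : a⁻¹ 2 = -a 2 + a 0 * a 1 := rfl

instance : Group Heis :=
  Group.ofLeftAxioms
    (fun a b c => by ext <;> simp <;> ring)
    (fun a => by ext <;> simp)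
    (fun a => by ext <;> simp)

/-- The element with coordinates `(z₁, z₂, z₃)` as an upper triangular matrix. -/
def toMatrix (a : Heis) : Matrix (Fin 3) (Fin 3) ℂ :=
  !![1, a 0, a 2; 0, 1, a 1; 0, 0, 1]

/-- The group law is the multiplication of matrices. -/
theorem toMatrix_mul (a b : Heis) : toMatrix (a * b) = toMatrix a * toMatrix b := by
  ext i j
  fin_cases i <;> fin_cases j <;>
    simp [toMatrix, Matrix.mul_apply, Fin.sum_univ_three] <;> ring

theorem continuous_coord (i : Fin 3) : Continuous (fun a : Heis => a i) := continuous_apply i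

theorem continuous_mk {X : Type*} [TopologicalSpace X] {f : X → Heis}
    (h : ∀ i, Continuous fun x => f x i) : Continuous f := continuous_pi h

instance : IsTopologicalGroup Heis where
  continuous_mul := by
    have h1 := fun i => (continuous_coord i).comp (continuous_fst (X := Heis) (Y := Heis))
    have h2 := fun i => (continuous_coord i).comp (continuous_snd (X := Heis) (Y := Heis))
    refine continuous_mk fun i => ?_
    fin_cases i
    · exact (h1 0).add (h2 0)
    · exact (h1 1).add (h2 1)
    · exact ((h1 2).add (h2 2)).add ((h1 0).mul (h2 1))
  continuous_inv := by
    refine continuous_mk fun i => ?_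
    fin_cases i
    · exact (continuous_coord 0).neg
    · exact (continuous_coord 1).neg
    · exact (continuous_coord 2).neg.add ((continuous_coord 0).mul (continuous_coord 1))

end Heis

/-- The lattice `Γ = H(3; ℤ[i])` of the elements with Gaussian integer coordinates. -/
def latticeGamma : Subgroup Heis where
  carrier := {a | ∀ i, a i ∈ GaussianInt.toComplex.range}
  mul_mem' := by
    intro a b ha hb i
    fin_cases i
    · exact add_mem (ha 0) (hb 0)
    · exact add_mem (ha 1) (hb 1)
    · exact add_mem (add_mem (ha 2) (hb 2)) (mul_mem (ha 0) (hb 1))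
  one_mem' := by
    intro i
    fin_cases i <;> exact zero_mem _
  inv_mem' := by
    intro a ha i
    fin_cases i
    · exact neg_mem (ha 0)
    · exact neg_mem (ha 1)
    · exact add_mem (neg_mem (ha 2)) (mul_mem (ha 0) (ha 1))

theorem gaussianInt_eq_zero {x : ℂ} (hx : x ∈ GaussianInt.toComplex.range) (h : ‖x‖ < 1) :
    x = 0 := by
  obtain ⟨n, rfl⟩ := hx
  have h1 : ((n.norm : ℤ) : ℝ) < 1 := by
    have := GaussianInt.intCast_real_norm n
    rw [this, Complex.normSq_eq_norm_sq]
    nlinarith [norm_nonneg (GaussianInt.toComplex n)]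
  have h2 : n.norm < 1 := by exact_mod_cast h1
  have h3 : n.norm = 0 := le_antisymm (by omega) (GaussianInt.norm_nonneg n)
  rw [GaussianInt.norm_eq_zero] at h3
  simp [h3]

instance : DiscreteTopology latticeGamma := by
  refine discreteTopology_of_isOpen_singleton_one ?_
  have hU : IsOpen {a : Heis | ∀ i, ‖a i‖ < 1} := by
    have : {a : Heis | ∀ i, ‖a i‖ < 1} = ⋂ i, {a : Heis | ‖a i‖ < 1} := by
      ext a; simp
    rw [this]
    exact isOpen_iInter_of_finite fun i =>
      isOpen_lt (Heis.continuous_coord i).norm continuous_const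
  have : ({1} : Set latticeGamma) = (fun a : latticeGamma => (a : Heis)) ⁻¹'
      {a : Heis | ∀ i, ‖a i‖ < 1} := by
    ext a
    simp only [Set.mem_singleton_iff, Set.mem_preimage, Set.mem_ofPred_eq]
    constructor
    · rintro rfl i
      fin_cases i <;> simp
    · intro h
      apply Subtype.ext
      have := fun i => gaussianInt_eq_zero (a.2 i) (h i)
      ext
      · exact this 0
      · exact this 1
      · exact this 2
  rw [this]
  exact hU.preimage continuous_subtype_val

instance : ProperlyDiscontinuousSMul latticeGamma Heis :=
  latticeGamma.properlyDiscontinuousSMul_of_tendsto_cofinite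
    (latticeGamma.tendsto_coe_cofinite_of_discrete
      (SetLike.isDiscrete_iff_discreteTopology.mpr inferInstance))

/-- The Iwasawa manifold `Γ \ H(3; ℂ)` (the quotient by left multiplication), with the complex
structure for which the projection from `H(3; ℂ) = ℂ³` is locally biholomorphic. -/
abbrev IwasawaManifold : Type := MulAction.orbitRel.Quotient latticeGamma Heis

/-! ### Nakamura's family -/

/-- The parameters `t = (t₁₁, t₁₂, t₂₁, t₂₂, t₃₁, t₃₂) ∈ ℂ⁶`, where `t_{ij} = t (i-1) (j-1)`. -/
abbrev Param : Type := Fin 3 → Fin 2 → ℂ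

/-- `D(t) = t₁₁ t₂₂ - t₁₂ t₂₁`. -/
def nakD (t : Param) : ℂ := t 0 0 * t 1 1 - t 0 1 * t 1 0

/-- `A(z̄) = (t₁₁ t₂₁ z̄₁ z̄₁ + 2 t₁₁ t₂₂ z̄₁ z̄₂ + t₁₂ t₂₂ z̄₂ z̄₂) / 2`. -/
def nakA (t : Param) (z1 z2 : ℂ) : ℂ :=
  (t 0 0 * t 1 0 * conj z1 * conj z1 + 2 * t 0 0 * t 1 1 * conj z1 * conj z2
    + t 0 1 * t 1 1 * conj z2 * conj z2) / 2

/-- Nakamura's complex coordinates `ζ^t = (ζ₁, ζ₂, ζ₃)` on `H(3; ℂ)`. -/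
def nakZeta (t : Param) (z : Heis) : Fin 3 → ℂ :=
  ![z 0 + (t 0 0 * conj (z 0) + t 0 1 * conj (z 1)),
    z 1 + (t 1 0 * conj (z 0) + t 1 1 * conj (z 1)),
    z 2 + ((t 2 0 + t 1 0 * z 0) * conj (z 0) + (t 2 1 + t 1 1 * z 0) * conj (z 1))
      + nakA t (z 0) (z 1) - nakD t * conj (z 2)]

/-- `1 + |D|² - (|t₁₁|² + |t₂₂|² + t₁₂ t̄₂₁ + t̄₁₂ t₂₁)`, a real number. It is the Jacobian
of `(z₁, z₂) ↦ (ζ₁, ζ₂)`, and `1 - |D|²` is that of `z₃ ↦ ζ₃`. -/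
def nakDelta (t : Param) : ℂ :=
  1 + nakD t * conj (nakD t) - (t 0 0 * conj (t 0 0) + t 1 1 * conj (t 1 1)
    + t 0 1 * conj (t 1 0) + conj (t 0 1) * t 1 0)

/-- The parameters for which the `ζ^t` are coordinates, i.e. the Jacobian of `ζ^t` is not zero. -/
def admissible : Set Param := {t | nakDelta t ≠ 0 ∧ 1 - nakD t * conj (nakD t) ≠ 0}

/-- The inverse of `nakZeta t`. -/
def nakZetaInv (t : Param) (w : Fin 3 → ℂ) : Heis :=
  let u1 := w 0 - t 0 0 * conj (w 0) - t 0 1 * conj (w 1)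
  let u2 := w 1 - t 1 0 * conj (w 0) - t 1 1 * conj (w 1)
  let z1 := ((1 - t 1 0 * conj (t 0 1) - t 1 1 * conj (t 1 1)) * u1
    + (t 0 0 * conj (t 0 1) + t 0 1 * conj (t 1 1)) * u2) / nakDelta t
  let z2 := ((1 - t 0 0 * conj (t 0 0) - t 0 1 * conj (t 1 0)) * u2
    + (t 1 0 * conj (t 0 0) + t 1 1 * conj (t 1 0)) * u1) / nakDelta t
  let r := w 2 - ((t 2 0 + t 1 0 * z1) * conj z1 + (t 2 1 + t 1 1 * z1) * conj z2) - nakA t z1 z2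
  ![z1, z2, (r + nakD t * conj r) / (1 - nakD t * conj (nakD t))]

theorem conj_nakDelta (t : Param) : conj (nakDelta t) = nakDelta t := by
  simp only [nakDelta, map_sub, map_add, map_mul, map_one, Complex.conj_conj]
  ring

theorem continuous_nakZeta (t : Param) : Continuous (nakZeta t) := by
  have h := Heis.continuous_coord
  have hc := fun i => Complex.continuous_conj.comp (h i)
  simp only [Function.comp_def] at hc
  have h0 := h 0; have h1 := h 1; have h2 := h 2
  have c0 := hc 0; have c1 := hc 1; have c2 := hc 2
  refine continuous_pi fun i => ?_
  fin_cases i <;> simp only [nakZeta, nakA] <;> fun_prop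

theorem continuous_nakZetaInv (t : Param) : Continuous (nakZetaInv t) := by
  have h : ∀ i, Continuous fun w : Fin 3 → ℂ => w i := fun i => continuous_apply i
  have hc := fun i => Complex.continuous_conj.comp (h i)
  simp only [Function.comp_def] at hc
  have h0 := h 0; have h1 := h 1; have h2 := h 2
  have c0 := hc 0; have c1 := hc 1; have c2 := hc 2
  refine Heis.continuous_mk fun i => ?_
  fin_cases i <;> simp only [nakZetaInv, nakA, div_eq_mul_inv, map_add, map_sub, map_mul] <;>
    simp <;> fun_prop

theorem nakZetaInv_nakZeta {t : Param} (ht : t ∈ admissible) (z : Heis) :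
    nakZetaInv t (nakZeta t z) = z := by
  obtain ⟨h1, h2⟩ := ht
  have e0 : nakZetaInv t (nakZeta t z) 0 = z 0 := by
    simp only [nakZetaInv, nakZeta, Matrix.cons_val_zero, Matrix.cons_val_one]
    rw [div_eq_iff h1]
    simp only [nakDelta, nakD, map_sub, map_add, map_mul, Complex.conj_conj]
    ring
  have e1 : nakZetaInv t (nakZeta t z) 1 = z 1 := by
    simp only [nakZetaInv, nakZeta, Matrix.cons_val_zero, Matrix.cons_val_one]
    rw [div_eq_iff h1]
    simp only [nakDelta, nakD, map_sub, map_add, map_mul, Complex.conj_conj]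
    ring
  refine Heis.ext e0 e1 ?_
  have e2 : ∀ w, nakZetaInv t w 2 =
      let z1 := nakZetaInv t w 0
      let z2 := nakZetaInv t w 1
      let r := w 2 - ((t 2 0 + t 1 0 * z1) * conj z1 + (t 2 1 + t 1 1 * z1) * conj z2)
        - nakA t z1 z2
      (r + nakD t * conj r) / (1 - nakD t * conj (nakD t)) := fun _ => rfl
  rw [e2]
  simp only [e0, e1]
  rw [div_eq_iff h2]
  simp only [nakZeta, Matrix.cons_val, map_sub, map_add, map_mul, Complex.conj_conj]
  ring

theorem nakZeta_nakZetaInv {t : Param} (ht : t ∈ admissible) (w : Fin 3 → ℂ) :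
    nakZeta t (nakZetaInv t w) = w := by
  obtain ⟨h1, h2⟩ := ht
  have k1 : conj (nakDelta t) ≠ 0 := by rwa [conj_nakDelta]
  have hd := conj_nakDelta t
  have e0 : nakZeta t (nakZetaInv t w) 0 = w 0 := by
    simp only [nakZetaInv, nakZeta, Matrix.cons_val_zero, Matrix.cons_val_one, map_div₀, hd]
    rw [mul_div_assoc', mul_div_assoc', ← add_div, ← add_div, div_eq_iff h1]
    simp only [nakDelta, nakD, map_sub, map_add, map_mul, map_one, Complex.conj_conj]
    ring
  have e1 : nakZeta t (nakZetaInv t w) 1 = w 1 := by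
    simp only [nakZetaInv, nakZeta, Matrix.cons_val_zero, Matrix.cons_val_one, map_div₀, hd]
    rw [mul_div_assoc', mul_div_assoc', ← add_div, ← add_div, div_eq_iff h1]
    simp only [nakDelta, nakD, map_sub, map_add, map_mul, map_one, Complex.conj_conj]
    ring
  have e2 : nakZetaInv t w 2 =
      let z1 := nakZetaInv t w 0
      let z2 := nakZetaInv t w 1
      let r := w 2 - ((t 2 0 + t 1 0 * z1) * conj z1 + (t 2 1 + t 1 1 * z1) * conj z2)
        - nakA t z1 z2
      (r + nakD t * conj r) / (1 - nakD t * conj (nakD t)) := rfl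
  have e3 : nakZeta t (nakZetaInv t w) 2 = w 2 := by
    have : ∀ z, nakZeta t z 2 = z 2 + ((t 2 0 + t 1 0 * z 0) * conj (z 0)
      + (t 2 1 + t 1 1 * z 0) * conj (z 1)) + nakA t (z 0) (z 1) - nakD t * conj (z 2) :=
      fun _ => rfl
    rw [this, e2]
    dsimp only
    generalize nakZetaInv t w 0 = z1
    generalize nakZetaInv t w 1 = z2
    generalize nakD t = d at *
    generalize nakA t z1 z2 = a
    simp only [map_div₀, map_sub, map_add, map_mul, map_one, Complex.conj_conj]
    have h3 : 1 - conj d * d ≠ 0 := by rwa [mul_comm]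
    field_simp
    ring
  funext i
  fin_cases i
  · exact e0
  · exact e1
  · exact e3

/-- In the coordinates `ζ^t`, left multiplication by `w` is a holomorphic polynomial map. -/
theorem nakZeta_mul (t : Param) (w z : Heis) :
    let ζ := nakZeta t z
    let wt : Fin 3 → ℂ := fun j => w j + (t j 0 * conj (w 0) + t j 1 * conj (w 1))
    nakZeta t (w * z) = ![ζ 0 + wt 0, ζ 1 + wt 1,
      ζ 2 + wt 2 + w 0 * ζ 1 + (t 1 0 * conj (w 0) + t 1 1 * conj (w 1)) * (ζ 0 + w 0)
        + nakA t (w 0) (w 1) - nakD t * conj (w 2)] := by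
  funext i
  fin_cases i <;> simp [nakZeta, nakA, nakD] <;> ring

/-- For admissible `t` the coordinates `ζ^t` are a homeomorphism from `H(3; ℂ)` to `ℂ³`. -/
def nakHomeo (t : admissible) : Heis ≃ₜ (Fin 3 → ℂ) where
  toFun := nakZeta t
  invFun := nakZetaInv t
  left_inv := nakZetaInv_nakZeta t.2
  right_inv := nakZeta_nakZetaInv t.2
  continuous_toFun := continuous_nakZeta t
  continuous_invFun := continuous_nakZetaInv t

/-- `H(3; ℂ)` with the complex structure for which the `ζ^t` are holomorphic coordinates. -/
def NakCover (_t : admissible) : Type := Heis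

namespace NakCover

variable (t : admissible)

instance : TopologicalSpace (NakCover t) := inferInstanceAs (TopologicalSpace Heis)
instance : T2Space (NakCover t) := inferInstanceAs (T2Space Heis)
instance : LocallyCompactSpace (NakCover t) := inferInstanceAs (LocallyCompactSpace Heis)
instance : MulAction latticeGamma (NakCover t) := inferInstanceAs (MulAction latticeGamma Heis)
instance : ContinuousConstSMul latticeGamma (NakCover t) :=
  inferInstanceAs (ContinuousConstSMul latticeGamma Heis)
instance : IsCancelSMul latticeGamma (NakCover t) :=
  inferInstanceAs (IsCancelSMul latticeGamma Heis)
instance : ProperlyDiscontinuousSMul latticeGamma (NakCover t) :=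
  inferInstanceAs (ProperlyDiscontinuousSMul latticeGamma Heis)

instance : ChartedSpace (Fin 3 → ℂ) (NakCover t) :=
  (nakHomeo t).toOpenPartialHomeomorph.singletonChartedSpace rfl

end NakCover

/-- The member `M_t` of Nakamura's family of deformations of the Iwasawa manifold: the quotient
`Γ \ H(3; ℂ)` with the local holomorphic coordinates `ζ^t`. -/
abbrev NakamuraManifold (t : admissible) : Type :=
  MulAction.orbitRel.Quotient latticeGamma (NakCover t)

/-- The sub-family `t₁₁ = t₂₂ = 0`, `t₁₂ = -t₂₁`. -/
def subFamily : Set Param := {t | t 0 0 = 0 ∧ t 1 1 = 0 ∧ t 0 1 = -t 1 0}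

end

/-!
The manifold `M_t` is the quotient of `ℂ³`, with the coordinates `ζ^t`, by the transformations
`nakLeft t γ`, which are affine and holomorphic, also in `t`. All statements are reduced to
invariant objects on `ℂ³` by means of the covering map `unif`, which is locally biholomorphic
(`IsUniformizing`).

*The left invariant forms.* The coordinate `z₁` and the function `t₂₁ z̄₁ + t₂₂ z̄₂` are real linear
forms `a` and `b` in `ζ₁, ζ₂`, and `φ₁ = dζ₁`, `φ₂ = dζ₂`, `φ₃ = dζ₃ - a dζ₂ - b dζ₁` is an
invariant coframe of forms of type `(1, 0)`. Only `φ₃` is not closed; `dφ₃` has constant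
coefficients with respect to the coframe, and consists of a part `σ` of type `(2, 0)` (`torsion20`)
and a part `τ` of type `(1, 1)` (`torsion11`). Hence
`∂ ∂̄ (φ₃ ∧ φ̄₃) = τ ∧ τ̄ - σ ∧ σ̄ = κ φ₁ ∧ φ₂ ∧ φ̄₁ ∧ φ̄₂` with a real number `κ` depending on `t`
(`obstruction`), while `∂ ∂̄` vanishes on all other products `φ_j ∧ φ̄_k`.
The point is that *`M_t` admits an SKT metric if and only if `κ = 0`*.

*Existence.* If `κ = 0`, then the metric for which the coframe is unitary is SKT
(`admitsSKT_of_obstruction_eq_zero`). On the sub-family, `κ` is a multiple of `2 x - (1 - x)²` with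
`x = |t₂₁|²`, which vanishes for `x = 2 ± √3`.

*Non-existence.* Let `g` be an SKT metric on `M_t`, lifted to `ℂ³`, with fundamental form `ω`.
Integration over a fundamental domain of the lattice replaces the averaging of `g`: left invariant
vector fields have volume preserving flows which commute with the lattice, so that the derivative of
an invariant function along such a field has mean zero (`setIntegral_fderiv_frame`). Therefore the
mean of an exterior derivative on left invariant fields is given by the brackets alone
(`setIntegral_extDeriv_frame`). Applied to `ω` and then to `∂̄ ω` this expresses the mean of
`∂ ∂̄ ω = 0` on the dual frame as a nonzero multiple of `κ h`, where `h > 0` is the mean of the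
squared length of the third vector of the frame; so `κ = 0` (`IsInvariantSKT.obstruction_eq_zero`).
But `κ` is `-1` at `t = 0` and continuous there.

*The family.* The total space is the quotient of `H(3; ℂ) × U` by the action of the lattice on the
first factor, with the global chart `(ζ^t, t)`; here `U` is the open set of admissible parameters.
The projection onto `U` is proper because the unit cell of the lattice is relatively compact.
-/

noncomputable section

/-! ### Quotients of a complex manifold with a global chart by holomorphic transformations -/

section Quotient

set_option linter.unusedSectionVars false

open MulAction Filter

variable {C : Type*} [TopologicalSpace C] {G : Type*} [Group G] [MulAction G C]
  [ProperlyDiscontinuousSMul G C] [ContinuousConstSMul G C] [IsCancelSMul G C]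
  [T2Space C] [LocallyCompactSpace C]
  {F : Type*} [NormedAddCommGroup F] [NormedSpace ℂ F] [ChartedSpace F C]

/-- The transformation of the vector space `F` which the element `γ` of the group induces through
the global chart `Φ`. It is meaningful on `Φ.target`. -/
def deck (Φ : OpenPartialHomeomorph C F) (γ : G) (y : F) : F := Φ (γ • Φ.symm y)

variable (G) in
/-- `Φ` is a chart of `C` which is defined everywhere and is the only one used, and the group `G`
acts holomorphically in it. -/
structure IsUniformizing (Φ : OpenPartialHomeomorph C F) : Prop where
  source_eq : Φ.source = Set.univ
  chartAt_eq : ∀ x : C, chartAt F x = Φ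
  contDiffOn_deck : ∀ γ : G, ContDiffOn ℂ ω (deck Φ γ) Φ.target

variable (G) in
/-- The uniformization of the quotient `C / G` by the range of the global chart. -/
def unif (Φ : OpenPartialHomeomorph C F) (y : F) : orbitRel.Quotient G C :=
  Quotient.mk _ (Φ.symm y)

namespace IsUniformizing

variable {Φ : OpenPartialHomeomorph C F}

theorem mk_smul (γ : G) (x : C) :
    (Quotient.mk _ (γ • x) : orbitRel.Quotient G C) = Quotient.mk _ x :=
  Quotient.sound ⟨γ, rfl⟩

variable (hΦ : IsUniformizing G Φ)
include hΦ

theorem apply_mem_target (x : C) : Φ x ∈ Φ.target :=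
  Φ.map_source (by rw [hΦ.source_eq]; trivial)

theorem symm_apply_apply (x : C) : Φ.symm (Φ x) = x :=
  Φ.left_inv (by rw [hΦ.source_eq]; trivial)

theorem deck_mem (γ : G) (y : F) : deck Φ γ y ∈ Φ.target := hΦ.apply_mem_target _

theorem unif_deck (γ : G) (y : F) : unif G Φ (deck Φ γ y) = unif G Φ y := by
  rw [unif, deck, hΦ.symm_apply_apply, mk_smul]
  rfl

theorem deck_inv_deck (γ : G) {y : F} (hy : y ∈ Φ.target) : deck Φ γ⁻¹ (deck Φ γ y) = y := by
  rw [deck, deck, hΦ.symm_apply_apply, inv_smul_smul, Φ.right_inv hy]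

theorem unif_surjective (m : orbitRel.Quotient G C) : ∃ y ∈ Φ.target, unif G Φ y = m := by
  obtain ⟨x, rfl⟩ := Quotient.exists_rep m
  exact ⟨Φ x, hΦ.apply_mem_target x, by rw [unif, hΦ.symm_apply_apply]⟩

/-- The charts of the quotient are local inverses of the uniformization. -/
theorem exists_localInverse {e : OpenPartialHomeomorph (orbitRel.Quotient G C) F}
    (he : e ∈ atlas F (orbitRel.Quotient G C)) :
    ∃ s : OpenPartialHomeomorph (orbitRel.Quotient G C) C,
      (s.symm : C → orbitRel.Quotient G C) = Quotient.mk _ ∧ e = s.trans Φ := by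
  obtain ⟨q, rfl⟩ := he
  exact ⟨_, IsLocalHomeomorph.localInverseAt_symm _ _, by rw [hΦ.chartAt_eq]⟩

theorem symm_eq_unif {e : OpenPartialHomeomorph (orbitRel.Quotient G C) F}
    (he : e ∈ atlas F (orbitRel.Quotient G C)) (y : F) : e.symm y = unif G Φ y := by
  obtain ⟨s, hs, rfl⟩ := hΦ.exists_localInverse he
  simp only [OpenPartialHomeomorph.coe_trans_symm, Function.comp_apply, hs, unif]

theorem target_subset {e : OpenPartialHomeomorph (orbitRel.Quotient G C) F}
    (he : e ∈ atlas F (orbitRel.Quotient G C)) : e.target ⊆ Φ.target := by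
  obtain ⟨s, hs, rfl⟩ := hΦ.exists_localInverse he
  rw [OpenPartialHomeomorph.trans_target]
  exact Set.inter_subset_left

/-- A chart of the quotient, composed with the uniformization, is locally a transformation from the
group, because the projection of `C` onto the quotient is locally injective. -/
theorem eventually_chart_unif {e : OpenPartialHomeomorph (orbitRel.Quotient G C) F}
    (he : e ∈ atlas F (orbitRel.Quotient G C)) {y : F} (hy : y ∈ Φ.target)
    (hye : unif G Φ y ∈ e.source) :
    ∃ γ : G, ∀ᶠ y' in 𝓝 y, unif G Φ y' ∈ e.source ∧ e (unif G Φ y') = deck Φ γ y' := by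
  obtain ⟨s, hs, rfl⟩ := hΦ.exists_localInverse he
  have hms : ∀ {m}, m ∈ (s.trans Φ).source ↔ m ∈ s.source := by
    simp [hΦ.source_eq]
  rw [hms] at hye
  have h1 : (Quotient.mk _ (s (unif G Φ y)) : orbitRel.Quotient G C)
      = Quotient.mk _ (Φ.symm y) := by
    rw [← hs, s.left_inv hye, hs]; rfl
  obtain ⟨γ, hγ⟩ := Quotient.exact h1
  have hγ' : γ • Φ.symm y = s (unif G Φ y) := hγ
  have hmem : γ • Φ.symm y ∈ s.target := hγ' ▸ s.map_source hye
  have hcont : ContinuousAt (fun y' => γ • Φ.symm y') y :=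
    (Φ.continuousAt_symm hy).const_smul γ
  refine ⟨γ, ?_⟩
  filter_upwards [hcont (s.open_target.mem_nhds hmem)] with y' hy'
  have hy'' : γ • Φ.symm y' ∈ s.target := hy'
  have h2 : unif G Φ y' = s.symm (γ • Φ.symm y') := by rw [hs, mk_smul]; rfl
  refine ⟨?_, ?_⟩
  · rw [hms, h2]; exact s.map_target hy''
  · rw [OpenPartialHomeomorph.coe_trans, Function.comp_apply, h2, s.right_inv hy'']; rfl

theorem isManifold : IsManifold 𝓘(ℂ, F) ω (orbitRel.Quotient G C) := by
  refine isManifold_of_contDiffOn _ _ _ fun e e' he he' y hy => ?_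
  simp only [modelWithCornersSelf_coe, modelWithCornersSelf_coe_symm, Function.id_comp,
    Function.comp_id, Set.preimage_id, Set.range_id, Set.inter_univ] at hy ⊢
  rw [OpenPartialHomeomorph.trans_source] at hy
  have hyt : y ∈ Φ.target := hΦ.target_subset he hy.1
  have hye : unif G Φ y ∈ e'.source := by
    rw [← hΦ.symm_eq_unif he]; exact hy.2
  obtain ⟨γ, hγ⟩ := hΦ.eventually_chart_unif he' hyt hye
  refine ContDiffAt.contDiffWithinAt ?_
  refine ((hΦ.contDiffOn_deck γ).contDiffAt (Φ.open_target.mem_nhds hyt)).congr_of_eventuallyEq ?_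
  filter_upwards [hγ] with y' hy'
  rw [← hy'.2, ← hΦ.symm_eq_unif he]
  rfl

/-- The uniformization is locally biholomorphic. -/
theorem exists_local_section {y : F} (hy : y ∈ Φ.target) :
    ∃ r : orbitRel.Quotient G C → F, r (unif G Φ y) = y ∧
      ContMDiffAt 𝓘(ℂ, F) 𝓘(ℂ, F) ω r (unif G Φ y) ∧
      (∀ᶠ y' in 𝓝 y, r (unif G Φ y') = y') ∧
      ∀ᶠ m in 𝓝 (unif G Φ y), r m ∈ Φ.target ∧ unif G Φ (r m) = m := by
  have := hΦ.isManifold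
  set e := chartAt F (unif G Φ y) with he
  have hea : e ∈ atlas F (orbitRel.Quotient G C) := chart_mem_atlas _ _
  have hes := mem_chart_source F (unif G Φ y)
  obtain ⟨γ, hγ⟩ := hΦ.eventually_chart_unif hea hy hes
  have hev : ∀ᶠ y' in 𝓝 y, deck Φ γ⁻¹ (e (unif G Φ y')) = y' := by
    filter_upwards [hγ, Φ.open_target.mem_nhds hy] with y' hy' hyt
    rw [hy'.2, hΦ.deck_inv_deck γ hyt]
  refine ⟨fun m => deck Φ γ⁻¹ (e m), hev.self_of_nhds, ?_, hev, ?_⟩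
  · have h1 : ContMDiffAt 𝓘(ℂ, F) 𝓘(ℂ, F) ω e (unif G Φ y) :=
      contMDiffAt_of_mem_maximalAtlas (IsManifold.chart_mem_maximalAtlas _) hes
    have h2 : ContMDiffAt 𝓘(ℂ, F) 𝓘(ℂ, F) ω (deck Φ γ⁻¹) (e (unif G Φ y)) := by
      refine ContDiffAt.contMDiffAt ?_
      refine (hΦ.contDiffOn_deck γ⁻¹).contDiffAt (Φ.open_target.mem_nhds ?_)
      exact hΦ.target_subset hea (e.map_source hes)
    exact h2.comp _ h1
  · filter_upwards [e.open_source.mem_nhds hes] with m hm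
    refine ⟨hΦ.deck_mem _ _, ?_⟩
    rw [hΦ.unif_deck, ← hΦ.symm_eq_unif hea, e.left_inv hm]

theorem contMDiffAt_unif {y : F} (hy : y ∈ Φ.target) :
    ContMDiffAt 𝓘(ℂ, F) 𝓘(ℂ, F) ω (unif G Φ) y := by
  have := hΦ.isManifold
  set e := chartAt F (unif G Φ y) with he
  have hea : e ∈ atlas F (orbitRel.Quotient G C) := chart_mem_atlas _ _
  have hes := mem_chart_source F (unif G Φ y)
  obtain ⟨γ, hγ⟩ := hΦ.eventually_chart_unif hea hy hes
  have h1 : ContMDiffAt 𝓘(ℂ, F) 𝓘(ℂ, F) ω e.symm (deck Φ γ y) := by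
    refine contMDiffOn_chart_symm.contMDiffAt (e.open_target.mem_nhds ?_)
    rw [← hγ.self_of_nhds.2]
    exact e.map_source hes
  have h2 : ContMDiffAt 𝓘(ℂ, F) 𝓘(ℂ, F) ω (deck Φ γ) y :=
    ((hΦ.contDiffOn_deck γ).contDiffAt (Φ.open_target.mem_nhds hy)).contMDiffAt
  refine (h1.comp y h2).congr_of_eventuallyEq (Eventually.of_forall fun y' => ?_)
  rw [Function.comp_apply, hΦ.symm_eq_unif hea, hΦ.unif_deck]

/-- A map from the quotient is holomorphic if its composition with the uniformization is. -/
theorem contMDiff_of_comp_unif {E' : Type*} [NormedAddCommGroup E'] [NormedSpace ℂ E']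
    {N : Type*} [TopologicalSpace N] [ChartedSpace E' N] {h : orbitRel.Quotient G C → N}
    (hh : ∀ y ∈ Φ.target, ContMDiffAt 𝓘(ℂ, F) 𝓘(ℂ, E') ω (h ∘ unif G Φ) y) :
    ContMDiff 𝓘(ℂ, F) 𝓘(ℂ, E') ω h := by
  intro m
  obtain ⟨y, hy, rfl⟩ := hΦ.unif_surjective m
  obtain ⟨r, hr, hrs, -, hm⟩ := hΦ.exists_local_section hy
  have h1 := hh y hy
  rw [← hr] at h1
  refine (h1.comp (unif G Φ y) hrs).congr_of_eventuallyEq ?_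
  filter_upwards [hm] with m hm
  simp [hm.2]

theorem injective_mfderiv_unif {y : F} (hy : y ∈ Φ.target) :
    Function.Injective (mfderiv 𝓘(ℂ, F) 𝓘(ℂ, F) (unif G Φ) y) := by
  obtain ⟨r, hr, hrs, hev, -⟩ := hΦ.exists_local_section hy
  have h1 : mfderiv 𝓘(ℂ, F) 𝓘(ℂ, F) (r ∘ unif G Φ) y = ContinuousLinearMap.id ℂ _ := by
    rw [← mfderiv_id]
    exact Filter.EventuallyEq.mfderiv_eq (hev.mono fun _ h => h)
  rw [mfderiv_comp y (hrs.mdifferentiableAt (by simp))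
    ((hΦ.contMDiffAt_unif hy).mdifferentiableAt (by simp))] at h1
  intro v w hvw
  have h2 := DFunLike.congr_fun h1 v
  have h3 := DFunLike.congr_fun h1 w
  rw [ContinuousLinearMap.comp_apply, hvw, ← ContinuousLinearMap.comp_apply, h3] at h2
  exact h2.symm

theorem surjective_mfderiv_unif {y : F} (hy : y ∈ Φ.target) :
    Function.Surjective (mfderiv 𝓘(ℂ, F) 𝓘(ℂ, F) (unif G Φ) y) := by
  obtain ⟨r, hr, hrs, -, hm⟩ := hΦ.exists_local_section hy
  have h1 : mfderiv 𝓘(ℂ, F) 𝓘(ℂ, F) (unif G Φ ∘ r) (unif G Φ y)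
      = ContinuousLinearMap.id ℂ _ := by
    rw [← mfderiv_id]
    exact Filter.EventuallyEq.mfderiv_eq (hm.mono fun _ h => h.2)
  have h2 := (hΦ.contMDiffAt_unif hy).mdifferentiableAt (by simp)
  rw [← hr] at h2
  rw [mfderiv_comp (unif G Φ y) h2 (hrs.mdifferentiableAt (by simp))] at h1
  have h3 : Function.Surjective (mfderiv 𝓘(ℂ, F) 𝓘(ℂ, F) (unif G Φ) (r (unif G Φ y))) :=
    fun v => ⟨mfderiv 𝓘(ℂ, F) 𝓘(ℂ, F) r (unif G Φ y) v, DFunLike.congr_fun h1 v⟩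
  rwa [hr] at h3

end IsUniformizing

end Quotient

/-! ### The operator `∂̄` on forms of type `(1, 1)` -/

section Dbar

open Filter

variable {E : Type*} [NormedAddCommGroup E] [NormedSpace ℂ E]

variable (E) in
/-- Multiplication by `i`, as a real linear map. -/
def mulI : E →L[ℝ] E := Complex.I • ContinuousLinearMap.id ℝ E

/-- The component of type `(1, 2)` of a form of degree three whose other component is of
type `(2, 1)`. -/
def proj12 (γ : E [⋀^Fin 3]→L[ℝ] ℂ) : E [⋀^Fin 3]→L[ℝ] ℂ :=
  (1 / 2 : ℂ) • (γ + Complex.I • γ.compContinuousLinearMap (mulI E))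

/-- `∂̄ α`, for a form `α` of type `(1, 1)`. -/
def dbar (α : E → E [⋀^Fin 2]→L[ℝ] ℂ) (y : E) : E [⋀^Fin 3]→L[ℝ] ℂ := proj12 (extDeriv α y)

theorem dbar_apply (α : E → E [⋀^Fin 2]→L[ℝ] ℂ) (y : E) (v : Fin 3 → E) :
    dbar α y v =
      1 / 2 * (extDeriv α y v + Complex.I * extDeriv α y (fun i => Complex.I • v i)) := rfl

theorem isOfType_fderiv {k p q : ℕ} {α : E → E [⋀^Fin k]→L[ℝ] ℂ} {y : E}
    (hα : DifferentiableAt ℝ α y) (ht : ∀ᶠ y' in 𝓝 y, IsOfType p q (α y')) (u : E) :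
    IsOfType p q (fderiv ℝ α y u) := by
  intro c v
  have h := hα.hasFDerivAt
  have h1 := (h.continuousAlternatingMap_apply_const (fun i => c • v i)).fderiv
  have h2 := ((h.continuousAlternatingMap_apply_const v).const_mul (c ^ p * conj c ^ q)).fderiv
  have h3 : (fun y => α y fun i => c • v i) =ᶠ[𝓝 y] fun y => c ^ p * conj c ^ q * α y v :=
    ht.mono fun y' hy' => hy' c v
  rw [h3.fderiv_eq, h2] at h1
  exact (DFunLike.congr_fun h1 u).symm

/-- The exterior derivative of a form of type `(1, 1)` has only components of types `(2, 1)`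
and `(1, 2)`. -/
theorem extDeriv_smul_of_type11 {α : E → E [⋀^Fin 2]→L[ℝ] ℂ} {y : E}
    (hα : DifferentiableAt ℝ α y) (ht : ∀ᶠ y' in 𝓝 y, IsOfType 1 1 (α y')) (c : ℂ)
    (v : Fin 3 → E) :
    extDeriv α y (fun i => c • v i) = c * conj c *
      (c.re * extDeriv α y v + c.im * extDeriv α y (fun i => Complex.I • v i)) := by
  have ht' := isOfType_fderiv hα ht
  have key : ∀ (c : ℂ) (u : E) (w : Fin 2 → E), fderiv ℝ α y (c • u) (fun i => c • w i) =
      c * conj c * (c.re * fderiv ℝ α y u w + c.im * fderiv ℝ α y (Complex.I • u) w) := by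
    intro c u w
    rw [ht' (c • u) c w]
    have hcu : c • u = (c.re : ℝ) • u + (c.im : ℝ) • Complex.I • u := by
      conv_lhs => rw [← Complex.re_add_im c]
      rw [add_smul, mul_smul]
      rfl
    rw [hcu, map_add, map_smul, map_smul]
    simp only [ContinuousAlternatingMap.add_apply, ContinuousAlternatingMap.smul_apply,
      Complex.real_smul, pow_one]
  simp only [extDeriv, ContinuousAlternatingMap.alternatizeUncurryFin_apply]
  have hr : ∀ (c : ℂ) (i : Fin 3), (i.removeNth fun i => c • v i) =
      fun j => c • (i.removeNth v) j := fun _ _ => rfl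
  have hI := key Complex.I
  simp only [Complex.I_re, Complex.I_im, Complex.conj_I, Complex.ofReal_zero,
    Complex.ofReal_one, zero_mul, one_mul, zero_add, mul_neg, Complex.I_mul_I, neg_neg] at hI
  simp only [hr, key c, hI, Finset.mul_sum, ← Finset.sum_add_distrib, zsmul_eq_mul]
  exact Finset.sum_congr rfl fun i _ => by ring

/-- For a form `α` of type `(1, 1)`, `dbar α` is the component of type `(1, 2)` of `dα`. -/
theorem isDelbar_dbar {U : Set E} (hU : IsOpen U) {α : E → E [⋀^Fin 2]→L[ℝ] ℂ}
    (hα : DifferentiableOn ℝ α U) (ht : ∀ y ∈ U, IsOfType 1 1 (α y)) :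
    IsDelbar 1 1 U α (dbar α) := by
  intro y hy
  have hs := extDeriv_smul_of_type11 (hα.differentiableAt (hU.mem_nhds hy))
    ((hU.eventually_mem hy).mono ht)
  have hs2 : ∀ (c : ℂ) (v : Fin 3 → E), extDeriv α y (fun i => Complex.I • c • v i) =
      c * conj c * (-c.im * extDeriv α y v
        + c.re * extDeriv α y (fun i => Complex.I • v i)) := by
    intro c v
    simp only [smul_smul]
    rw [hs]
    simp only [map_mul, Complex.conj_I, Complex.mul_re, Complex.mul_im, Complex.I_re,
      Complex.I_im]
    push_cast
    linear_combination (-c * conj c * (-c.im * extDeriv α y v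
        + c.re * extDeriv α y (fun i => Complex.I • v i))) * Complex.I_sq
  refine ⟨fun c v => ?_, fun c v => ?_⟩
  · rw [dbar_apply, dbar_apply, hs2, hs]
    generalize extDeriv α y v = a
    generalize extDeriv α y (fun i => Complex.I • v i) = b
    have hc : conj c = c.re - c.im * Complex.I := by
      rw [Complex.ext_iff]; simp
    rw [hc]
    linear_combination (1 / 2 * c * (c.re - c.im * Complex.I) * (c.im * b)) * Complex.I_sq
  · simp only [ContinuousAlternatingMap.sub_apply]
    rw [dbar_apply, dbar_apply, hs2, hs]
    generalize extDeriv α y v = a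
    generalize extDeriv α y (fun i => Complex.I • v i) = b
    have hc : c = c.re + c.im * Complex.I := (Complex.re_add_im c).symm
    generalize conj c = d at *
    generalize c.re = x at *
    generalize c.im = z at *
    subst hc
    linear_combination ((x + z * Complex.I) * d * (z * b) / 2) * Complex.I_sq

theorem eq_dbar_of_isDelbar {U : Set E} {α : E → E [⋀^Fin 2]→L[ℝ] ℂ}
    {β : E → E [⋀^Fin 3]→L[ℝ] ℂ} (h : IsDelbar 1 1 U α β) {y : E} (hy : y ∈ U) :
    β y = dbar α y := by
  obtain ⟨h1, h2⟩ := h y hy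
  ext v
  rw [dbar_apply]
  have e1 := h1 Complex.I v
  have e2 := h2 Complex.I v
  simp only [ContinuousAlternatingMap.sub_apply, Complex.conj_I] at e1 e2
  have e3 : extDeriv α y (fun i => Complex.I • v i) =
      -Complex.I * β y v + Complex.I * (extDeriv α y v - β y v) := by
    linear_combination e1 + e2
      + Complex.I * (2 * β y v - extDeriv α y v) * Complex.I_sq
  rw [e3]
  linear_combination (β y v - 1 / 2 * extDeriv α y v) * Complex.I_sq

theorem isOfType_zero {k p q : ℕ} : IsOfType p q (0 : E [⋀^Fin k]→L[ℝ] ℂ) := by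
  intro c v
  simp

/-- `∂ ∂̄ α = 0` means that `d ∂̄ α` has only a component of type `(1, 3)`. -/
theorem delDelbarEqZeroOn_iff {U : Set E} (hU : IsOpen U) {α : E → E [⋀^Fin 2]→L[ℝ] ℂ}
    (hα : DifferentiableOn ℝ α U) (ht : ∀ y ∈ U, IsOfType 1 1 (α y)) :
    DelDelbarEqZeroOn U α ↔ ∀ y ∈ U, IsOfType 1 3 (extDeriv (dbar α) y) := by
  constructor
  · rintro ⟨β, h1, h2⟩ y hy
    have h3 := (h2 y hy).2
    have h4 : β =ᶠ[𝓝 y] dbar α := by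
      filter_upwards [hU.mem_nhds hy] with y' hy' using eq_dbar_of_isDelbar h1 hy'
    rw [h4.extDeriv_eq] at h3
    simpa using h3
  · intro h
    refine ⟨dbar α, isDelbar_dbar hU hα ht, fun y hy => ⟨isOfType_zero, ?_⟩⟩
    simpa using h y hy

theorem IsOfType.comp {k p q : ℕ} {α : E [⋀^Fin k]→L[ℝ] ℂ} (h : IsOfType p q α) (L : E →L[ℂ] E) :
    IsOfType p q (α.compContinuousLinearMap (L.restrictScalars ℝ)) := by
  intro c v
  have := h c (fun i => L (v i))
  simpa [Function.comp_def] using this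

/-- Holomorphic maps commute with `∂̄`. -/
theorem dbar_pullback {α : E → E [⋀^Fin 2]→L[ℝ] ℂ} {f : E → E} {y : E}
    (hα : DifferentiableAt ℝ α (f y)) (hf : ContDiffAt ℂ ω f y) :
    dbar (fun x => (α (f x)).compContinuousLinearMap (fderiv ℝ f x)) y =
      (dbar α (f y)).compContinuousLinearMap (fderiv ℝ f y) := by
  have hfr : ContDiffAt ℝ ω f y := hf.restrict_scalars ℝ
  have hfc : fderiv ℝ f y = (fderiv ℂ f y).restrictScalars ℝ :=
    (hf.differentiableAt (by simp)).fderiv_restrictScalars ℝ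
  ext v
  rw [dbar_apply, extDeriv_pullback hα hfr (by simp)]
  simp only [ContinuousAlternatingMap.compContinuousLinearMap_apply, dbar_apply, hfc,
    Function.comp_def, ContinuousLinearMap.coe_restrictScalars', map_smul]

theorem ContDiffAt.extDeriv_of_top {k : ℕ} {α : E → E [⋀^Fin k]→L[ℝ] ℂ} {y : E}
    (hα : ContDiffAt ℝ ∞ α y) : ContDiffAt ℝ ∞ (extDeriv α) y := by
  have h := hα.fderiv_right (m := ∞) (by simp)
  exact (ContinuousAlternatingMap.alternatizeUncurryFinCLM ℝ E ℂ).contDiff.contDiffAt.comp y h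

theorem contDiffAt_dbar {α : E → E [⋀^Fin 2]→L[ℝ] ℂ} {y : E}
    (hα : ContDiffAt ℝ ∞ α y) : ContDiffAt ℝ ∞ (dbar α) y := by
  have h := hα.extDeriv_of_top
  have h2 : ContDiffAt ℝ ∞ (fun y => (extDeriv α y).compContinuousLinearMap (mulI E)) y := by
    have h3 := (ContinuousAlternatingMap.compContinuousLinearMapCLM (𝕜 := ℝ) (F := ℂ) (ι := Fin 3)
      (mulI E)).contDiff.contDiffAt.comp y h
    exact h3
  exact (h.add (h2.const_smul Complex.I)).const_smul (1 / 2 : ℂ)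

theorem extDeriv_two_apply {α : E → E [⋀^Fin 2]→L[ℝ] ℂ} {y : E} (hα : DifferentiableAt ℝ α y)
    (v : Fin 3 → E) :
    extDeriv α y v = fderiv ℝ (fun y => α y ![v 1, v 2]) y (v 0)
      - fderiv ℝ (fun y => α y ![v 0, v 2]) y (v 1)
      + fderiv ℝ (fun y => α y ![v 0, v 1]) y (v 2) := by
  have h0 : (0 : Fin 3).removeNth v = ![v 1, v 2] := by ext i; fin_cases i <;> rfl
  have h1 : (1 : Fin 3).removeNth v = ![v 0, v 2] := by ext i; fin_cases i <;> rfl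
  have h2 : (2 : Fin 3).removeNth v = ![v 0, v 1] := by ext i; fin_cases i <;> rfl
  rw [extDeriv_apply hα, Fin.sum_univ_three, h0, h1, h2]
  simp [sub_eq_add_neg]

theorem extDeriv_three_apply {α : E → E [⋀^Fin 3]→L[ℝ] ℂ} {y : E} (hα : DifferentiableAt ℝ α y)
    (v : Fin 4 → E) :
    extDeriv α y v = fderiv ℝ (fun y => α y ![v 1, v 2, v 3]) y (v 0)
      - fderiv ℝ (fun y => α y ![v 0, v 2, v 3]) y (v 1)
      + fderiv ℝ (fun y => α y ![v 0, v 1, v 3]) y (v 2)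
      - fderiv ℝ (fun y => α y ![v 0, v 1, v 2]) y (v 3) := by
  have h0 : (0 : Fin 4).removeNth v = ![v 1, v 2, v 3] := by ext i; fin_cases i <;> rfl
  have h1 : (1 : Fin 4).removeNth v = ![v 0, v 2, v 3] := by ext i; fin_cases i <;> rfl
  have h2 : (2 : Fin 4).removeNth v = ![v 0, v 1, v 3] := by ext i; fin_cases i <;> rfl
  have h3 : (3 : Fin 4).removeNth v = ![v 0, v 1, v 2] := by ext i; fin_cases i <;> rfl
  rw [extDeriv_apply hα, Fin.sum_univ_four, h0, h1, h2, h3]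
  simp [sub_eq_add_neg, pow_succ]

/-- The vanishing of `∂ ∂̄ α` is preserved by holomorphic maps. -/
theorem isOfType_extDeriv_dbar_pullback {α : E → E [⋀^Fin 2]→L[ℝ] ℂ} {f : E → E} {y : E}
    (hα : ContDiffAt ℝ ∞ α (f y)) (hf : ContDiffAt ℂ ω f y)
    (h : IsOfType 1 3 (extDeriv (dbar α) (f y))) :
    IsOfType 1 3
      (extDeriv (dbar fun x => (α (f x)).compContinuousLinearMap (fderiv ℝ f x)) y) := by
  have hfr : ContDiffAt ℝ ω f y := hf.restrict_scalars ℝ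
  have hev : (dbar fun x => (α (f x)).compContinuousLinearMap (fderiv ℝ f x)) =ᶠ[𝓝 y]
      fun x => (dbar α (f x)).compContinuousLinearMap (fderiv ℝ f x) := by
    have h1 : ∀ᶠ x in 𝓝 y, ContDiffAt ℂ ω f x := hf.eventually (by simp)
    have h2 : ∀ᶠ x in 𝓝 (f y), ContDiffAt ℝ 1 α x :=
      (hα.of_le (by exact_mod_cast le_top)).eventually (by simp)
    filter_upwards [h1, hfr.continuousAt.eventually h2] with x hx1 hx2
    exact dbar_pullback (hx2.differentiableAt (by simp)) hx1
  rw [hev.extDeriv_eq,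
    extDeriv_pullback ((contDiffAt_dbar hα).differentiableAt (by simp)) hfr (by simp),
    (hf.differentiableAt (by simp)).fderiv_restrictScalars ℝ]
  exact h.comp _

end Dbar

/-! ### SKT metrics on quotients as invariant tensors -/

section FundamentalForm

variable {E : Type*} [NormedAddCommGroup E] [NormedSpace ℂ E]

theorem fundamentalForm_apply' (g : E →L[ℝ] E →L[ℝ] ℝ) (v : Fin 2 → E) :
    fundamentalForm g v =
      (((g (Complex.I • v 0) (v 1) - g (Complex.I • v 1) (v 0)) / 2 : ℝ) : ℂ) := rfl

theorem fundamentalForm_bilinearComp (g : E →L[ℝ] E →L[ℝ] ℝ) (L : E →L[ℝ] E)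
    (hL : ∀ v, L (Complex.I • v) = Complex.I • L v) :
    fundamentalForm (g.bilinearComp L L) =
      (fundamentalForm g).compContinuousLinearMap L := by
  ext v
  simp [fundamentalForm_apply', hL]

theorem apply_smul_smul_of_invariant {g : E →L[ℝ] E →L[ℝ] ℝ}
    (hg : ∀ v w, g (Complex.I • v) (Complex.I • w) = g v w) (c : ℂ) (v w : E) :
    g (c • v) (c • w) = Complex.normSq c * g v w := by
  have hc : ∀ u : E, c • u = (c.re : ℝ) • u + (c.im : ℝ) • Complex.I • u := by
    intro u
    conv_lhs => rw [← Complex.re_add_im c]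
    rw [add_smul, mul_smul]
    rfl
  have h : g v (Complex.I • w) = -g (Complex.I • v) w := by
    rw [← hg v, smul_smul]
    simp
  rw [hc v, hc w]
  simp only [map_add, map_smul, add_apply, smul_apply,
    hg, h, smul_eq_mul, Complex.normSq_apply]
  ring

theorem isOfType_fundamentalForm {g : E →L[ℝ] E →L[ℝ] ℝ}
    (hg : ∀ v w, g (Complex.I • v) (Complex.I • w) = g v w) :
    IsOfType 1 1 (fundamentalForm g) := by
  intro c v
  rw [fundamentalForm_apply', fundamentalForm_apply']
  simp only [smul_comm Complex.I c]
  rw [apply_smul_smul_of_invariant hg, apply_smul_smul_of_invariant hg, pow_one, pow_one,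
    Complex.mul_conj]
  push_cast
  ring

variable [FiniteDimensional ℝ E]

variable (E) in
/-- The fundamental form as a continuous linear function of the metric. -/
def fundamentalFormCLM : (E →L[ℝ] E →L[ℝ] ℝ) →L[ℝ] (E [⋀^Fin 2]→L[ℝ] ℂ) :=
  LinearMap.toContinuousLinearMap
    { toFun := fundamentalForm
      map_add' := by
        intro g h
        ext v
        simp only [fundamentalForm_apply', ContinuousAlternatingMap.add_apply,
          add_apply]
        push_cast
        ring
      map_smul' := by
        intro c g
        ext v
        simp only [fundamentalForm_apply', ContinuousAlternatingMap.smul_apply,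
          smul_apply, smul_eq_mul, Complex.real_smul, RingHom.id_apply]
        push_cast
        ring }

theorem contDiffAt_fundamentalForm {g : E → E →L[ℝ] E →L[ℝ] ℝ} {y : E} {n : ℕ∞ω}
    (hg : ContDiffAt ℝ n g y) : ContDiffAt ℝ n (fun y => fundamentalForm (g y)) y := by
  have h := (fundamentalFormCLM E).contDiff.contDiffAt.comp y hg
  exact h

end FundamentalForm

theorem contDiffAt_bilinearComp {X E F : Type*} [NormedAddCommGroup X] [NormedSpace ℝ X]
    [NormedAddCommGroup E] [NormedSpace ℝ E] [NormedAddCommGroup F] [NormedSpace ℝ F]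
    {n : ℕ∞ω} {B : X → F →L[ℝ] F →L[ℝ] ℝ} {L : X → E →L[ℝ] F} {x : X}
    (hB : ContDiffAt ℝ n B x) (hL : ContDiffAt ℝ n L x) :
    ContDiffAt ℝ n (fun x => (B x).bilinearComp (L x) (L x)) x := by
  have h : ContDiffAt ℝ n (fun x => (ContinuousLinearMap.compL ℝ E F ℝ).flip (L x)) x :=
    contDiffAt_const.clm_apply hL
  exact h.clm_comp (hB.clm_comp hL)

section Bridge

open MulAction Filter

variable {C : Type*} [TopologicalSpace C] {G : Type*} [Group G] [MulAction G C]
  {F : Type*} [NormedAddCommGroup F] [NormedSpace ℂ F]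

variable (G) in
/-- The tensor `g` on the vector space `F` is an SKT metric which is invariant under the
transformations that the group `G` induces through the global chart `Φ`. -/
structure IsInvariantSKT (Φ : OpenPartialHomeomorph C F) (g : F → F →L[ℝ] F →L[ℝ] ℝ) : Prop where
  contDiff : ContDiff ℝ ∞ g
  symm : ∀ y v w, g y v w = g y w v
  pos : ∀ y v, v ≠ 0 → 0 < g y v v
  invariant : ∀ y v w, g y (Complex.I • v) (Complex.I • w) = g y v w
  deck_eq : ∀ (γ : G) y v w,
    g (deck Φ γ y) (fderiv ℝ (deck Φ γ) y v) (fderiv ℝ (deck Φ γ) y w) = g y v w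
  isOfType : ∀ y, IsOfType 1 3 (extDeriv (dbar fun y => fundamentalForm (g y)) y)

variable [ProperlyDiscontinuousSMul G C] [ContinuousConstSMul G C] [IsCancelSMul G C]
  [T2Space C] [LocallyCompactSpace C] [ChartedSpace F C] [FiniteDimensional ℝ F]
  {Φ : OpenPartialHomeomorph C F}

omit [FiniteDimensional ℝ F] in
/-- In the global chart, the transition maps between the charts of the quotient are compositions
of a chart with the uniformization. -/
theorem IsUniformizing.coe_transition (hΦ : IsUniformizing G Φ)
    {e : OpenPartialHomeomorph (orbitRel.Quotient G C) F}
    (he : e ∈ atlas F (orbitRel.Quotient G C))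
    (e' : OpenPartialHomeomorph (orbitRel.Quotient G C) F) :
    (e.symm.trans e' : F → F) = fun y => e' (unif G Φ y) := by
  funext y
  rw [OpenPartialHomeomorph.coe_trans, Function.comp_apply, hΦ.symm_eq_unif he]

/-- An invariant tensor descends to the quotient: it is its own local expression in all charts. -/
theorem admitsSKT_of_isInvariantSKT (hΦ : IsUniformizing G Φ) {g : F → F →L[ℝ] F →L[ℝ] ℝ}
    (hg : IsInvariantSKT G Φ g) : AdmitsSKT F (orbitRel.Quotient G C) := by
  refine ⟨⟨fun _ => g, fun e _ => hg.contDiff.contDiffOn, fun e _ y _ => hg.symm y,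
    fun e _ y _ => hg.pos y, fun e _ y _ => hg.invariant y, ?_⟩, fun e _ => ?_⟩
  · intro e he e' he' y hy v w
    rw [OpenPartialHomeomorph.trans_source] at hy
    rw [hΦ.coe_transition he]
    have hy2 : e.symm y ∈ e'.source := hy.2
    rw [hΦ.symm_eq_unif he] at hy2
    obtain ⟨γ, hγ⟩ := hΦ.eventually_chart_unif he' (hΦ.target_subset he hy.1) hy2
    have h1 : (fun y => e' (unif G Φ y)) =ᶠ[𝓝 y] deck Φ γ := hγ.mono fun _ h => h.2
    rw [h1.fderiv_eq, h1.self_of_nhds, hg.deck_eq]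
  · have h := hg.contDiff
    refine (delDelbarEqZeroOn_iff e.open_target (fun y _ => ?_) fun y _ => ?_).2
      fun y _ => hg.isOfType y
    · exact ((contDiffAt_fundamentalForm h.contDiffAt).differentiableAt
        (by simp)).differentiableWithinAt
    · exact isOfType_fundamentalForm (hg.invariant y)

/-- The pull-back of an SKT metric on the quotient by the uniformization. -/
theorem exists_isInvariantSKT_of_admitsSKT (hΦ : IsUniformizing G Φ) (htop : Φ.target = Set.univ)
    (h : AdmitsSKT F (orbitRel.Quotient G C)) :
    ∃ g : F → F →L[ℝ] F →L[ℝ] ℝ, IsInvariantSKT G Φ g := by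
  obtain ⟨h, hskt⟩ := h
  have hdeck : ∀ γ : G, ContDiff ℂ ω (deck Φ γ) := fun γ => by
    have := hΦ.contDiffOn_deck γ
    rwa [htop, contDiffOn_univ] at this
  have hdeckC : ∀ (γ : G) y, fderiv ℝ (deck Φ γ) y = (fderiv ℂ (deck Φ γ) y).restrictScalars ℝ :=
    fun γ y => ((hdeck γ).contDiffAt.differentiableAt (by simp)).fderiv_restrictScalars ℝ
  have hdeckR : ∀ (γ : G) y, DifferentiableAt ℝ (deck Φ γ) y := fun γ y =>
    ((hdeck γ).contDiffAt.differentiableAt (by simp)).restrictScalars ℝ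
  have hinj : ∀ (γ : G) y v, fderiv ℝ (deck Φ γ) y v = 0 → v = 0 := by
    intro γ y v hv
    have h1 : deck Φ γ⁻¹ ∘ deck Φ γ = id := by
      funext y
      exact hΦ.deck_inv_deck γ (by rw [htop]; trivial)
    have h2 := fderiv_comp y (hdeckR γ⁻¹ _) (hdeckR γ y)
    rw [h1, fderiv_id] at h2
    have h3 := DFunLike.congr_fun h2 v
    rwa [ContinuousLinearMap.comp_apply, hv, map_zero] at h3
  -- charts composed with the uniformization are locally transformations from the group
  have hloc : ∀ e ∈ atlas F (orbitRel.Quotient G C), ∀ y, unif G Φ y ∈ e.source →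
      ∃ γ : G, ∀ᶠ y' in 𝓝 y, unif G Φ y' ∈ e.source ∧ e (unif G Φ y') = deck Φ γ y' :=
    fun e he y hy => hΦ.eventually_chart_unif he (by rw [htop]; trivial) hy
  have hdiff : ∀ e ∈ atlas F (orbitRel.Quotient G C), ∀ y, unif G Φ y ∈ e.source →
      DifferentiableAt ℝ (fun y => e (unif G Φ y)) y := by
    intro e he y hy
    obtain ⟨γ, hγ⟩ := hloc e he y hy
    exact (hdeckR γ y).congr_of_eventuallyEq (hγ.mono fun _ h => h.2)
  set ch := fun y => chartAt F (unif G Φ y) with hch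
  have hca : ∀ y, ch y ∈ atlas F (orbitRel.Quotient G C) := fun y => chart_mem_atlas _ _
  have hcs : ∀ y, unif G Φ y ∈ (ch y).source := fun y => mem_chart_source _ _
  set g : F → F →L[ℝ] F →L[ℝ] ℝ := fun y =>
    (h.inChart (ch y) (ch y (unif G Φ y))).bilinearComp
      (fderiv ℝ (fun x => ch y (unif G Φ x)) y) (fderiv ℝ (fun x => ch y (unif G Φ x)) y) with hg0
  have hun : ∀ e ∈ atlas F (orbitRel.Quotient G C), ∀ m ∈ e.source, unif G Φ (e m) = m :=
    fun e he m hm => by rw [← hΦ.symm_eq_unif he, e.left_inv hm]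
  -- by the transformation rule, any chart can be used to compute `g`
  have hgen : ∀ e ∈ atlas F (orbitRel.Quotient G C), ∀ y, unif G Φ y ∈ e.source → ∀ v w,
      g y v w = h.inChart e (e (unif G Φ y)) (fderiv ℝ (fun x => e (unif G Φ x)) y v)
        (fderiv ℝ (fun x => e (unif G Φ x)) y w) := by
    intro e he y hy v w
    have hu := hun _ (hca y) _ (hcs y)
    have hmem : ch y (unif G Φ y) ∈ ((ch y).symm.trans e).source := by
      rw [OpenPartialHomeomorph.trans_source]
      refine ⟨(ch y).map_source (hcs y), ?_⟩
      change (ch y).symm (ch y (unif G Φ y)) ∈ e.source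
      rwa [(ch y).left_inv (hcs y)]
    have h1 := h.transform (ch y) (hca y) e he _ hmem
      (fderiv ℝ (fun x => ch y (unif G Φ x)) y v) (fderiv ℝ (fun x => ch y (unif G Φ x)) y w)
    rw [hΦ.coe_transition (hca y)] at h1
    simp only [hu] at h1
    have h2 : (fun x => e (unif G Φ x)) ∘ (fun x => ch y (unif G Φ x)) =ᶠ[𝓝 y]
        fun x => e (unif G Φ x) := by
      obtain ⟨γ, hγ⟩ := hloc _ (hca y) y (hcs y)
      filter_upwards [hγ] with x hx
      simp only [Function.comp_apply, hun _ (hca y) _ hx.1]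
    have h3 := fderiv_comp y (hdiff e he (ch y (unif G Φ y)) (by rwa [hu]))
      (hdiff _ (hca y) y (hcs y))
    rw [h2.fderiv_eq] at h3
    rw [h3]
    exact h1
  have hlocal : ∀ y, ∃ e ∈ atlas F (orbitRel.Quotient G C), ∃ γ : G, deck Φ γ y ∈ e.target ∧
      g =ᶠ[𝓝 y] fun x => (h.inChart e (deck Φ γ x)).bilinearComp
        (fderiv ℝ (deck Φ γ) x) (fderiv ℝ (deck Φ γ) x) := by
    intro y
    obtain ⟨γ, hγ⟩ := hloc _ (hca y) y (hcs y)
    refine ⟨_, hca y, γ, ?_, ?_⟩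
    · rw [← hγ.self_of_nhds.2]
      exact (ch y).map_source (hcs y)
    · filter_upwards [hγ.eventually_nhds] with x hx
      have h1 : (fun x => ch y (unif G Φ x)) =ᶠ[𝓝 x] deck Φ γ := hx.mono fun _ h => h.2
      ext v w
      rw [hgen _ (hca y) x hx.self_of_nhds.1, h1.fderiv_eq, hx.self_of_nhds.2]
      rfl
  have hLI : ∀ (γ : G) y v, fderiv ℝ (deck Φ γ) y (Complex.I • v) =
      Complex.I • fderiv ℝ (deck Φ γ) y v := by
    intro γ y v
    rw [hdeckC]
    simp
  refine ⟨g, contDiff_iff_contDiffAt.2 fun y => ?_, fun y v w => ?_, fun y v hv => ?_,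
    fun y v w => ?_, fun γ y v w => ?_, fun y => ?_⟩
  · obtain ⟨e, he, γ, hm, hg⟩ := hlocal y
    refine ContDiffAt.congr_of_eventuallyEq ?_ hg
    have hd : ContDiffAt ℝ ω (deck Φ γ) y := (hdeck γ).contDiffAt.restrict_scalars ℝ
    have h1 : ContDiffAt ℝ ∞ (fun x => h.inChart e (deck Φ γ x)) y :=
      ((h.smooth e he).contDiffAt (e.open_target.mem_nhds hm)).comp y (hd.of_le (by simp))
    have h2 : ContDiffAt ℝ ∞ (fun x => fderiv ℝ (deck Φ γ) x) y :=
      hd.fderiv_right (m := ∞) (by simp)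
    exact contDiffAt_bilinearComp h1 h2
  · obtain ⟨e, he, γ, hm, hg⟩ := hlocal y
    rw [hg.self_of_nhds]
    exact h.symm e he _ hm _ _
  · obtain ⟨e, he, γ, hm, hg⟩ := hlocal y
    rw [hg.self_of_nhds]
    exact h.pos e he _ hm _ fun h0 => hv (hinj γ y v h0)
  · obtain ⟨e, he, γ, hm, hg⟩ := hlocal y
    rw [hg.self_of_nhds]
    simp only [ContinuousLinearMap.bilinearComp_apply, hLI]
    exact h.invariant e he _ hm _ _
  · have hs := hcs y
    rw [hgen (ch y) (hca y) y hs, hgen (ch y) (hca y) _ (by rwa [hΦ.unif_deck]), hΦ.unif_deck]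
    have h2 : (fun x => ch y (unif G Φ x)) ∘ deck Φ γ = fun x => ch y (unif G Φ x) := by
      funext x
      simp only [Function.comp_apply, hΦ.unif_deck]
    have h3 := fderiv_comp y (hdiff _ (hca y) (deck Φ γ y) (by rwa [hΦ.unif_deck])) (hdeckR γ y)
    rw [h2] at h3
    rw [h3]
    rfl
  · obtain ⟨e, he, γ, hm, hg⟩ := hlocal y
    have hsm := fun z hz => contDiffAt_fundamentalForm
      ((h.smooth e he).contDiffAt (e.open_target.mem_nhds hz) (x := z))
    have ht : IsOfType 1 3
        (extDeriv (dbar fun z => fundamentalForm (h.inChart e z)) (deck Φ γ y)) := by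
      refine (delDelbarEqZeroOn_iff e.open_target (fun z hz => ?_) fun z hz => ?_).1
        (hskt e he) _ hm
      · exact ((hsm z hz).differentiableAt (by simp)).differentiableWithinAt
      · exact isOfType_fundamentalForm (h.invariant e he z hz)
    have hp := isOfType_extDeriv_dbar_pullback (hsm _ hm) (hdeck γ).contDiffAt ht
    have hev : (fun y => fundamentalForm (g y)) =ᶠ[𝓝 y] fun x =>
        (fundamentalForm (h.inChart e (deck Φ γ x))).compContinuousLinearMap
          (fderiv ℝ (deck Φ γ) x) := by
      filter_upwards [hg] with x hx
      rw [hx]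
      exact fundamentalForm_bilinearComp _ _ (hLI γ x)
    have hev2 : dbar (fun y => fundamentalForm (g y)) =ᶠ[𝓝 y] dbar fun x =>
        (fundamentalForm (h.inChart e (deck Φ γ x))).compContinuousLinearMap
          (fderiv ℝ (deck Φ γ) x) := by
      filter_upwards [hev.extDeriv] with x hx
      rw [dbar, dbar, hx]
    rwa [hev2.extDeriv_eq]

end Bridge

/-! ### A coframe on `ℂ³` with two closed forms -/

section Coframe

/-- The real linear form `a₀ y₁ + a₁ y₂ + a₂ ȳ₁ + a₃ ȳ₂` on `ℂ³`. -/
def linForm (a : Fin 4 → ℂ) : (Fin 3 → ℂ) →L[ℝ] ℂ :=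
  LinearMap.toContinuousLinearMap
    { toFun := fun y => a 0 * y 0 + a 1 * y 1 + a 2 * conj (y 0) + a 3 * conj (y 1)
      map_add' := by
        intro y z
        simp only [Pi.add_apply, map_add]
        ring
      map_smul' := by
        intro c y
        simp only [Pi.smul_apply, Complex.real_smul, map_mul, Complex.conj_ofReal,
          RingHom.id_apply]
        ring }

theorem linForm_apply (a : Fin 4 → ℂ) (y : Fin 3 → ℂ) :
    linForm a y = a 0 * y 0 + a 1 * y 1 + a 2 * conj (y 0) + a 3 * conj (y 1) := rfl

/-- The coordinate `y_j`, as a real linear form. -/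
def coordForm (j : Fin 3) : (Fin 3 → ℂ) →L[ℝ] ℂ := ContinuousLinearMap.proj j

@[simp] theorem coordForm_apply (j : Fin 3) (v : Fin 3 → ℂ) : coordForm j v = v j := rfl

/-- The form `φ₃ = dy₃ - a(y) dy₂ - b(y) dy₁`, for real linear forms `a` and `b`. Together with
`φ₁ = dy₁` and `φ₂ = dy₂` it is a coframe of forms of type `(1, 0)` on `ℂ³`. -/
def coframe (a b : Fin 4 → ℂ) (y : Fin 3 → ℂ) : (Fin 3 → ℂ) →L[ℝ] ℂ :=
  coordForm 2 - linForm a y • coordForm 1 - linForm b y • coordForm 0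

theorem coframe_apply (a b : Fin 4 → ℂ) (y v : Fin 3 → ℂ) :
    coframe a b y v = v 2 - linForm a y * v 1 - linForm b y * v 0 := rfl

/-- The component of type `(2, 0)` of `dφ₃`, see `coframe`. -/
def torsion20 (a b : Fin 4 → ℂ) (u v : Fin 3 → ℂ) : ℂ :=
  (b 1 - a 0) * (u 0 * v 1 - u 1 * v 0)

/-- The component of type `(1, 1)` of `dφ₃`, see `coframe`. -/
def torsion11 (a b : Fin 4 → ℂ) (u v : Fin 3 → ℂ) : ℂ :=
  b 2 * (u 0 * conj (v 0) - v 0 * conj (u 0)) + b 3 * (u 0 * conj (v 1) - v 0 * conj (u 1))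
    + a 2 * (u 1 * conj (v 0) - v 1 * conj (u 0)) + a 3 * (u 1 * conj (v 1) - v 1 * conj (u 1))

/-- The number `κ` with `∂ ∂̄ (φ₃ ∧ φ̄₃) = κ φ₁ ∧ φ₂ ∧ φ̄₁ ∧ φ̄₂`, see `coframe`. -/
def obstruction (a b : Fin 4 → ℂ) : ℂ :=
  b 2 * conj (a 3) + conj (b 2) * a 3 - b 3 * conj (b 3) - a 2 * conj (a 2)
    - (a 0 - b 1) * conj (a 0 - b 1)

/-- The structure equation: the left hand side is the value of `dφ₃` on `(u, v)`. -/
theorem torsion_eq (a b : Fin 4 → ℂ) (u v : Fin 3 → ℂ) :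
    linForm a v * u 1 + linForm b v * u 0 - linForm a u * v 1 - linForm b u * v 0 =
      torsion20 a b u v + torsion11 a b u v := by
  simp only [linForm_apply, torsion20, torsion11]
  ring

theorem torsion20_smul_I (a b : Fin 4 → ℂ) (u v : Fin 3 → ℂ) :
    torsion20 a b (Complex.I • u) (Complex.I • v) = -torsion20 a b u v := by
  simp only [torsion20, Pi.smul_apply, smul_eq_mul]
  linear_combination (b 1 - a 0) * (u 0 * v 1 - u 1 * v 0) * Complex.I_sq

theorem torsion11_smul_I (a b : Fin 4 → ℂ) (u v : Fin 3 → ℂ) :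
    torsion11 a b (Complex.I • u) (Complex.I • v) = torsion11 a b u v := by
  simp only [torsion11, Pi.smul_apply, smul_eq_mul, map_mul, Complex.conj_I]
  have h : ∀ x y : ℂ, Complex.I * x * (-Complex.I * y) = x * y := by
    intro x y
    linear_combination (-x * y) * Complex.I_sq
  simp only [h]

/-- The metric for which the coframe `φ₁, φ₂, φ₃` is unitary, see `coframe`. -/
def coframeMetric (a b : Fin 4 → ℂ) (y : Fin 3 → ℂ) :
    (Fin 3 → ℂ) →L[ℝ] (Fin 3 → ℂ) →L[ℝ] ℝ :=
  (innerSL ℝ).bilinearComp (coordForm 0) (coordForm 0)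
    + (innerSL ℝ).bilinearComp (coordForm 1) (coordForm 1)
    + (innerSL ℝ).bilinearComp (coframe a b y) (coframe a b y)

theorem coframeMetric_apply (a b : Fin 4 → ℂ) (y v w : Fin 3 → ℂ) :
    coframeMetric a b y v w = (conj (v 0) * w 0).re + (conj (v 1) * w 1).re
      + (conj (coframe a b y v) * coframe a b y w).re := by
  simp [coframeMetric, Complex.inner, mul_comm]

theorem contDiff_coframe (a b : Fin 4 → ℂ) : ContDiff ℝ ∞ (coframe a b) :=
  (contDiff_const.sub ((linForm a).contDiff.smul contDiff_const)).sub
    ((linForm b).contDiff.smul contDiff_const)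

theorem contDiff_coframeMetric (a b : Fin 4 → ℂ) : ContDiff ℝ ∞ (coframeMetric a b) :=
  contDiff_const.add (contDiff_iff_contDiffAt.2 fun _ =>
    contDiffAt_bilinearComp contDiffAt_const (contDiff_coframe a b).contDiffAt)

theorem coframe_smul_I (a b : Fin 4 → ℂ) (y v : Fin 3 → ℂ) :
    coframe a b y (Complex.I • v) = Complex.I * coframe a b y v := by
  simp only [coframe_apply, Pi.smul_apply, smul_eq_mul]
  ring

theorem coframeMetric_symm (a b : Fin 4 → ℂ) (y v w : Fin 3 → ℂ) :
    coframeMetric a b y v w = coframeMetric a b y w v := by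
  simp only [coframeMetric_apply, Complex.mul_re, Complex.conj_re, Complex.conj_im]
  ring

theorem coframeMetric_pos (a b : Fin 4 → ℂ) (y v : Fin 3 → ℂ) (hv : v ≠ 0) :
    0 < coframeMetric a b y v v := by
  have h : ∀ z : ℂ, (conj z * z).re = Complex.normSq z := by
    intro z
    rw [mul_comm, Complex.mul_conj, Complex.ofReal_re]
  rw [coframeMetric_apply, h, h, h]
  by_contra hn
  have n0 := Complex.normSq_nonneg (v 0)
  have n1 := Complex.normSq_nonneg (v 1)
  have n2 := Complex.normSq_nonneg (coframe a b y v)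
  have e0 : v 0 = 0 := Complex.normSq_eq_zero.1 (by linarith)
  have e1 : v 1 = 0 := Complex.normSq_eq_zero.1 (by linarith)
  have e2 : coframe a b y v = 0 := Complex.normSq_eq_zero.1 (by linarith)
  rw [coframe_apply, e0, e1, mul_zero, mul_zero, sub_zero, sub_zero] at e2
  refine hv (funext fun i => ?_)
  fin_cases i <;> assumption

theorem coframeMetric_smul_I (a b : Fin 4 → ℂ) (y v w : Fin 3 → ℂ) :
    coframeMetric a b y (Complex.I • v) (Complex.I • w) = coframeMetric a b y v w := by
  have h : ∀ z w : ℂ, conj (Complex.I * z) * (Complex.I * w) = conj z * w := by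
    intro z w
    rw [map_mul, Complex.conj_I]
    linear_combination (-conj z * w) * Complex.I_sq
  simp only [coframeMetric_apply, coframe_smul_I, Pi.smul_apply, smul_eq_mul, h]

/-- The fundamental form is `(i / 2) (φ₁ ∧ φ̄₁ + φ₂ ∧ φ̄₂ + φ₃ ∧ φ̄₃)`. -/
theorem fundamentalForm_coframeMetric (a b : Fin 4 → ℂ) (y : Fin 3 → ℂ) (v : Fin 2 → Fin 3 → ℂ) :
    fundamentalForm (coframeMetric a b y) v = Complex.I / 2 *
      ((v 0 0 * conj (v 1 0) - v 1 0 * conj (v 0 0))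
      + (v 0 1 * conj (v 1 1) - v 1 1 * conj (v 0 1))
      + (coframe a b y (v 0) * conj (coframe a b y (v 1))
        - coframe a b y (v 1) * conj (coframe a b y (v 0)))) := by
  rw [fundamentalForm_apply', coframeMetric_apply, coframeMetric_apply, coframe_smul_I,
    coframe_smul_I]
  apply Complex.ext <;>
  simp only [Pi.smul_apply, smul_eq_mul, Complex.ofReal_re, Complex.ofReal_im, Complex.mul_re,
    Complex.mul_im, Complex.conj_re, Complex.conj_im, Complex.I_re, Complex.I_im, Complex.sub_re,
    Complex.sub_im, Complex.add_re, Complex.add_im, Complex.div_re, Complex.div_im,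
    Complex.re_ofNat, Complex.im_ofNat, Complex.normSq_ofNat] <;>
  ring

theorem hasFDerivAt_coframe (a b : Fin 4 → ℂ) (y v : Fin 3 → ℂ) :
    HasFDerivAt (fun y => coframe a b y v) (-(v 1 • linForm a) - v 0 • linForm b) y := by
  have h1 := (linForm a).hasFDerivAt (x := y)
  have h2 := (linForm b).hasFDerivAt (x := y)
  have h3 := ((h1.mul_const (v 1)).const_sub (v 2)).sub (h2.mul_const (v 0))
  exact h3

theorem hasFDerivAt_conj_coframe (a b : Fin 4 → ℂ) (y v : Fin 3 → ℂ) :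
    HasFDerivAt (fun y => conj (coframe a b y v))
      ((Complex.conjCLE : ℂ →L[ℝ] ℂ).comp (-(v 1 • linForm a) - v 0 • linForm b)) y :=
  (Complex.conjCLE : ℂ →L[ℝ] ℂ).hasFDerivAt.comp y (hasFDerivAt_coframe a b y v)

theorem extDeriv_fundamentalForm_coframeMetric (a b : Fin 4 → ℂ) (y : Fin 3 → ℂ)
    (v : Fin 3 → Fin 3 → ℂ) :
    let φ := coframe a b y
    let θ := fun u v => torsion20 a b u v + torsion11 a b u v
    extDeriv (fun y => fundamentalForm (coframeMetric a b y)) y v = Complex.I / 2 *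
      (θ (v 0) (v 1) * conj (φ (v 2)) - θ (v 0) (v 2) * conj (φ (v 1))
        + θ (v 1) (v 2) * conj (φ (v 0)) - φ (v 0) * conj (θ (v 1) (v 2))
        + φ (v 1) * conj (θ (v 0) (v 2)) - φ (v 2) * conj (θ (v 0) (v 1))) := by
  intro φ θ
  have hd : DifferentiableAt ℝ (fun y => fundamentalForm (coframeMetric a b y)) y :=
    (contDiffAt_fundamentalForm (contDiff_coframeMetric a b).contDiffAt).differentiableAt
      (by simp)
  rw [extDeriv_two_apply hd]
  have hf : ∀ (w : Fin 2 → Fin 3 → ℂ) (u : Fin 3 → ℂ),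
      fderiv ℝ (fun y => fundamentalForm (coframeMetric a b y) w) y u = Complex.I / 2 *
        ((-(w 0 1 * linForm a u) - w 0 0 * linForm b u) * conj (φ (w 1))
        + φ (w 0) * conj (-(w 1 1 * linForm a u) - w 1 0 * linForm b u)
        - (-(w 1 1 * linForm a u) - w 1 0 * linForm b u) * conj (φ (w 0))
        - φ (w 1) * conj (-(w 0 1 * linForm a u) - w 0 0 * linForm b u)) := by
    intro w u
    have h1 := (hasFDerivAt_coframe a b y (w 0)).mul (hasFDerivAt_conj_coframe a b y (w 1))
    have h2 := (hasFDerivAt_coframe a b y (w 1)).mul (hasFDerivAt_conj_coframe a b y (w 0))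
    have h3 := ((h1.sub h2).const_add ((w 0 0 * conj (w 1 0) - w 1 0 * conj (w 0 0))
      + (w 0 1 * conj (w 1 1) - w 1 1 * conj (w 0 1)))).const_mul (Complex.I / 2)
    simp only [fundamentalForm_coframeMetric]
    have h4 := h3.fderiv
    simp only [Pi.mul_apply, Pi.sub_apply] at h4
    rw [h4]
    simp only [smul_apply, add_apply, sub_apply, neg_apply, ContinuousLinearMap.comp_apply,
      smul_eq_mul, ContinuousLinearEquiv.coe_coe, Complex.conjCLE_apply, φ]
    ring
  simp only [hf, Matrix.cons_val_zero, Matrix.cons_val_one, ← torsion_eq, θ, map_sub, map_add,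
    map_mul, map_neg]
  ring

theorem dbar_fundamentalForm_coframeMetric (a b : Fin 4 → ℂ) (y : Fin 3 → ℂ)
    (v : Fin 3 → Fin 3 → ℂ) :
    let φ := coframe a b y
    let σ := torsion20 a b
    let τ := torsion11 a b
    dbar (fun y => fundamentalForm (coframeMetric a b y)) y v = Complex.I / 2 *
      (τ (v 0) (v 1) * conj (φ (v 2)) - τ (v 0) (v 2) * conj (φ (v 1))
        + τ (v 1) (v 2) * conj (φ (v 0)) - φ (v 0) * conj (σ (v 1) (v 2))
        + φ (v 1) * conj (σ (v 0) (v 2)) - φ (v 2) * conj (σ (v 0) (v 1))) := by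
  intro φ σ τ
  rw [dbar_apply, extDeriv_fundamentalForm_coframeMetric,
    extDeriv_fundamentalForm_coframeMetric]
  simp only [torsion20_smul_I, torsion11_smul_I, coframe_smul_I, map_add, map_neg, map_mul,
    Complex.conj_I, φ, σ, τ]
  ring_nf
  simp only [show Complex.I ^ 3 = -Complex.I by rw [pow_succ, Complex.I_sq]; ring]
  ring

/-- If the number `κ` vanishes, then the metric for which the coframe is unitary is SKT. -/
theorem extDeriv_dbar_fundamentalForm_coframeMetric {a b : Fin 4 → ℂ} (h : obstruction a b = 0)
    (y : Fin 3 → ℂ) :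
    extDeriv (dbar fun y => fundamentalForm (coframeMetric a b y)) y = 0 := by
  ext v
  have hd : DifferentiableAt ℝ (dbar fun y => fundamentalForm (coframeMetric a b y)) y :=
    (contDiffAt_dbar (contDiffAt_fundamentalForm
      (contDiff_coframeMetric a b).contDiffAt)).differentiableAt (by simp)
  rw [extDeriv_three_apply hd]
  have hf : ∀ (w : Fin 3 → Fin 3 → ℂ) (u : Fin 3 → ℂ),
      fderiv ℝ (fun y => dbar (fun y => fundamentalForm (coframeMetric a b y)) y w) y u =
      Complex.I / 2 *
      (torsion11 a b (w 0) (w 1) * conj (-(w 2 1 * linForm a u) - w 2 0 * linForm b u)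
        - torsion11 a b (w 0) (w 2) * conj (-(w 1 1 * linForm a u) - w 1 0 * linForm b u)
        + torsion11 a b (w 1) (w 2) * conj (-(w 0 1 * linForm a u) - w 0 0 * linForm b u)
        - (-(w 0 1 * linForm a u) - w 0 0 * linForm b u) * conj (torsion20 a b (w 1) (w 2))
        + (-(w 1 1 * linForm a u) - w 1 0 * linForm b u) * conj (torsion20 a b (w 0) (w 2))
        - (-(w 2 1 * linForm a u) - w 2 0 * linForm b u) * conj (torsion20 a b (w 0) (w 1))) := by
    intro w u
    have h1 := fun i => hasFDerivAt_coframe a b y (w i)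
    have h2 := fun i => hasFDerivAt_conj_coframe a b y (w i)
    have h3 := ((((((h2 2).const_mul (torsion11 a b (w 0) (w 1))).sub
      ((h2 1).const_mul (torsion11 a b (w 0) (w 2)))).add
      ((h2 0).const_mul (torsion11 a b (w 1) (w 2)))).sub
      ((h1 0).mul_const (conj (torsion20 a b (w 1) (w 2))))).add
      ((h1 1).mul_const (conj (torsion20 a b (w 0) (w 2))))).sub
      ((h1 2).mul_const (conj (torsion20 a b (w 0) (w 1))))
    simp only [dbar_fundamentalForm_coframeMetric]
    have h4 := (h3.const_mul (Complex.I / 2)).fderiv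
    simp only [Pi.sub_apply, Pi.add_apply] at h4
    rw [h4]
    simp only [smul_apply, add_apply, sub_apply, neg_apply, ContinuousLinearMap.comp_apply,
      smul_eq_mul, ContinuousLinearEquiv.coe_coe, Complex.conjCLE_apply]
    ring
  simp only [hf, ContinuousAlternatingMap.coe_zero, Pi.zero_apply, Matrix.cons_val]
  simp only [torsion20, torsion11, linForm_apply, map_sub, map_add, map_mul, map_neg,
    Complex.conj_conj]
  simp only [obstruction, map_sub] at h
  -- the coefficient is the value of `φ₁ ∧ φ₂ ∧ φ̄₁ ∧ φ̄₂` on `v`, up to `i / 2`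
  linear_combination (Complex.I / 2 * (
    (v 0 0 * v 1 1 - v 0 1 * v 1 0) * (conj (v 2 0) * conj (v 3 1) - conj (v 2 1) * conj (v 3 0))
    - (v 0 0 * v 2 1 - v 0 1 * v 2 0) * (conj (v 1 0) * conj (v 3 1) - conj (v 1 1) * conj (v 3 0))
    + (v 0 0 * v 3 1 - v 0 1 * v 3 0) * (conj (v 1 0) * conj (v 2 1) - conj (v 1 1) * conj (v 2 0))
    + (v 1 0 * v 2 1 - v 1 1 * v 2 0) * (conj (v 0 0) * conj (v 3 1) - conj (v 0 1) * conj (v 3 0))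
    - (v 1 0 * v 3 1 - v 1 1 * v 3 0) * (conj (v 0 0) * conj (v 2 1) - conj (v 0 1) * conj (v 2 0))
    + (v 2 0 * v 3 1 - v 2 1 * v 3 0) * (conj (v 0 0) * conj (v 1 1) - conj (v 0 1) * conj (v 1 0))
    )) * h

end Coframe

/-! ### The coframe of Nakamura's manifolds -/

/-- The global chart `ζ^t` of the covering of `M_t`. -/
def nakChart (t : admissible) : OpenPartialHomeomorph (NakCover t) (Fin 3 → ℂ) :=
  (nakHomeo t).toOpenPartialHomeomorph

theorem nakChart_target (t : admissible) : (nakChart t).target = Set.univ := rfl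

/-- The translation part of the left multiplication by `w` in the coordinates `ζ^t`. -/
def nakShift (t : Param) (w : Heis) : Fin 3 → ℂ :=
  ![w 0 + (t 0 0 * conj (w 0) + t 0 1 * conj (w 1)),
    w 1 + (t 1 0 * conj (w 0) + t 1 1 * conj (w 1)),
    w 2 + (t 2 0 * conj (w 0) + t 2 1 * conj (w 1))
      + (t 1 0 * conj (w 0) + t 1 1 * conj (w 1)) * w 0 + nakA t (w 0) (w 1)
      - nakD t * conj (w 2)]

/-- The left multiplication by `w` in the coordinates `ζ^t`. -/
def nakLeft (t : Param) (w : Heis) (y : Fin 3 → ℂ) : Fin 3 → ℂ :=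
  ![y 0 + nakShift t w 0, y 1 + nakShift t w 1,
    y 2 + nakShift t w 2 + w 0 * y 1 + (t 1 0 * conj (w 0) + t 1 1 * conj (w 1)) * y 0]

theorem nakZeta_mul_eq_nakLeft (t : Param) (w z : Heis) :
    nakZeta t (w * z) = nakLeft t w (nakZeta t z) := by
  rw [nakZeta_mul]
  funext i
  fin_cases i
  · rfl
  · rfl
  · simp only [nakLeft, nakShift, Matrix.cons_val]
    ring_nf

theorem deck_nakChart (t : admissible) (γ : latticeGamma) :
    deck (nakChart t) γ = nakLeft t (γ : Heis) := by
  funext y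
  change nakZeta t ((γ : Heis) * nakZetaInv t y) = _
  rw [nakZeta_mul_eq_nakLeft, nakZeta_nakZetaInv t.2]

theorem contDiff_nakLeft (t : Param) (w : Heis) : ContDiff ℂ ω (nakLeft t w) := by
  refine contDiff_pi.2 fun i => ?_
  fin_cases i <;> simp only [nakLeft] <;> simp <;> fun_prop

theorem isUniformizing_nakChart (t : admissible) : IsUniformizing latticeGamma (nakChart t) where
  source_eq := rfl
  chartAt_eq _ := rfl
  contDiffOn_deck γ := by
    rw [deck_nakChart]
    exact (contDiff_nakLeft t γ).contDiffOn

theorem fderiv_nakLeft (t : Param) (w : Heis) (y v : Fin 3 → ℂ) :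
    fderiv ℝ (nakLeft t w) y v =
      ![v 0, v 1, v 2 + w 0 * v 1 + (t 1 0 * conj (w 0) + t 1 1 * conj (w 1)) * v 0] := by
  have h : ∀ j, HasFDerivAt (fun y : Fin 3 → ℂ => y j) (coordForm j) y :=
    fun j => (coordForm j).hasFDerivAt
  have h2 : HasFDerivAt (nakLeft t w) (ContinuousLinearMap.pi ![coordForm 0, coordForm 1,
      coordForm 2 + w 0 • coordForm 1
        + (t 1 0 * conj (w 0) + t 1 1 * conj (w 1)) • coordForm 0]) y := by
    refine hasFDerivAt_pi'.2 fun i => ?_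
    fin_cases i
    · exact (h 0).add_const _
    · exact (h 1).add_const _
    · exact (((h 2).add_const _).add ((h 1).const_mul (w 0))).add ((h 0).const_mul _)
  rw [h2.fderiv]
  funext i
  fin_cases i <;> rfl

/-- The coefficients of the coordinate `z₁`, as a real linear form in `ζ^t`. -/
def coefZ1 (t : Param) : Fin 4 → ℂ :=
  let p := 1 - t 1 0 * conj (t 0 1) - t 1 1 * conj (t 1 1)
  let q := t 0 0 * conj (t 0 1) + t 0 1 * conj (t 1 1)
  ![p / nakDelta t, q / nakDelta t, -(p * t 0 0 + q * t 1 0) / nakDelta t,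
    -(p * t 0 1 + q * t 1 1) / nakDelta t]

/-- The coefficients of the coordinate `z₂`, as a real linear form in `ζ^t`. -/
def coefZ2 (t : Param) : Fin 4 → ℂ :=
  let p := t 1 0 * conj (t 0 0) + t 1 1 * conj (t 1 0)
  let q := 1 - t 0 0 * conj (t 0 0) - t 0 1 * conj (t 1 0)
  ![p / nakDelta t, q / nakDelta t, -(p * t 0 0 + q * t 1 0) / nakDelta t,
    -(p * t 0 1 + q * t 1 1) / nakDelta t]

/-- The coefficients of `t₂₁ z̄₁ + t₂₂ z̄₂`, as a real linear form in `ζ^t`. -/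
def coefZbar (t : Param) : Fin 4 → ℂ :=
  ![t 1 0 * conj (coefZ1 t 2) + t 1 1 * conj (coefZ2 t 2),
    t 1 0 * conj (coefZ1 t 3) + t 1 1 * conj (coefZ2 t 3),
    t 1 0 * conj (coefZ1 t 0) + t 1 1 * conj (coefZ2 t 0),
    t 1 0 * conj (coefZ1 t 1) + t 1 1 * conj (coefZ2 t 1)]

theorem linForm_coefZ1 (t : Param) (y : Fin 3 → ℂ) :
    linForm (coefZ1 t) y = nakZetaInv t y 0 := by
  simp only [linForm_apply, coefZ1, nakZetaInv, Matrix.cons_val]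
  ring

theorem linForm_coefZ2 (t : Param) (y : Fin 3 → ℂ) :
    linForm (coefZ2 t) y = nakZetaInv t y 1 := by
  simp only [linForm_apply, coefZ2, nakZetaInv, Matrix.cons_val]
  ring

theorem linForm_coefZbar (t : Param) (y : Fin 3 → ℂ) :
    linForm (coefZbar t) y =
      t 1 0 * conj (nakZetaInv t y 0) + t 1 1 * conj (nakZetaInv t y 1) := by
  rw [← linForm_coefZ1, ← linForm_coefZ2]
  simp only [linForm_apply, coefZbar, Matrix.cons_val, map_add, map_mul, Complex.conj_conj]
  ring

theorem nakZetaInv_nakLeft {t : Param} (ht : t ∈ admissible) (w : Heis) (y : Fin 3 → ℂ) :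
    nakZetaInv t (nakLeft t w y) = w * nakZetaInv t y := by
  conv_lhs => rw [← nakZeta_nakZetaInv ht y, ← nakZeta_mul_eq_nakLeft, nakZetaInv_nakZeta ht]

theorem linForm_coefZ1_nakLeft {t : Param} (ht : t ∈ admissible) (w : Heis) (y : Fin 3 → ℂ) :
    linForm (coefZ1 t) (nakLeft t w y) = linForm (coefZ1 t) y + w 0 := by
  rw [linForm_coefZ1, linForm_coefZ1, nakZetaInv_nakLeft ht, Heis.mul_zero', add_comm]

theorem linForm_coefZbar_nakLeft {t : Param} (ht : t ∈ admissible) (w : Heis)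
    (y : Fin 3 → ℂ) :
    linForm (coefZbar t) (nakLeft t w y) =
      linForm (coefZbar t) y + (t 1 0 * conj (w 0) + t 1 1 * conj (w 1)) := by
  rw [linForm_coefZbar, linForm_coefZbar, nakZetaInv_nakLeft ht, Heis.mul_zero', Heis.mul_one',
    map_add, map_add]
  ring

/-- The coframe `φ₁ = dζ₁, φ₂ = dζ₂, φ₃ = dζ₃ - z₁ dζ₂ - (t₂₁ z̄₁ + t₂₂ z̄₂) dζ₁` is invariant under
left multiplications. -/
theorem coframe_nakLeft {t : Param} (ht : t ∈ admissible) (w : Heis) (y v : Fin 3 → ℂ) :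
    coframe (coefZ1 t) (coefZbar t) (nakLeft t w y) (fderiv ℝ (nakLeft t w) y v) =
      coframe (coefZ1 t) (coefZbar t) y v := by
  rw [coframe_apply, coframe_apply, linForm_coefZ1_nakLeft ht, linForm_coefZbar_nakLeft ht,
    fderiv_nakLeft]
  simp only [Matrix.cons_val]
  ring

theorem admitsSKT_of_obstruction_eq_zero (t : admissible)
    (h : obstruction (coefZ1 t) (coefZbar t) = 0) :
    AdmitsSKT (Fin 3 → ℂ) (NakamuraManifold t) := by
  refine admitsSKT_of_isInvariantSKT (isUniformizing_nakChart t)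
    (g := coframeMetric (coefZ1 t) (coefZbar t)) ?_
  refine ⟨contDiff_coframeMetric _ _, coframeMetric_symm _ _, coframeMetric_pos _ _,
    coframeMetric_smul_I _ _, fun γ y v w => ?_, fun y => ?_⟩
  · rw [deck_nakChart, coframeMetric_apply, coframeMetric_apply, coframe_nakLeft t.2,
      coframe_nakLeft t.2, fderiv_nakLeft, fderiv_nakLeft]
    rfl
  · rw [extDeriv_dbar_fundamentalForm_coframeMetric h]
    exact isOfType_zero

/-! ### The sub-family -/

theorem nakD_of_mem_subFamily {t : Param} (ht : t ∈ subFamily) : nakD t = t 1 0 ^ 2 := by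
  obtain ⟨h1, h2, h3⟩ := ht
  rw [nakD, h1, h2, h3]
  ring

theorem nakDelta_of_mem_subFamily {t : Param} (ht : t ∈ subFamily) :
    nakDelta t = (1 + (‖t 1 0‖ : ℂ) ^ 2) ^ 2 := by
  rw [nakDelta, nakD_of_mem_subFamily ht, ← Complex.mul_conj']
  obtain ⟨h1, h2, h3⟩ := ht
  rw [h1, h2, h3]
  simp only [map_pow, map_neg, map_zero]
  ring

theorem one_add_norm_sq_ne_zero (s : ℂ) : (1 + (‖s‖ : ℂ) ^ 2) ≠ 0 := by
  norm_cast
  positivity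

/-- A member of the sub-family is admissible if and only if `|t₂₁| ≠ 1`. -/
theorem mem_admissible_of_mem_subFamily {t : Param} (ht : t ∈ subFamily)
    (h : ‖t 1 0‖ ^ 2 ≠ 1) : t ∈ admissible := by
  constructor
  · rw [nakDelta_of_mem_subFamily ht]
    exact pow_ne_zero _ (one_add_norm_sq_ne_zero _)
  · rw [nakD_of_mem_subFamily ht, Complex.mul_conj']
    norm_cast
    rw [norm_pow]
    intro h1
    have h2 : (‖t 1 0‖ ^ 2 - 1) * (‖t 1 0‖ ^ 2 + 1) = 0 := by linear_combination -h1
    rcases mul_eq_zero.1 h2 with h3 | h3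
    · exact h (by linarith)
    · nlinarith [sq_nonneg ‖t 1 0‖]

theorem coefZ1_of_mem_subFamily {t : Param} (ht : t ∈ subFamily) :
    coefZ1 t = ![1 / (1 + (‖t 1 0‖ : ℂ) ^ 2), 0, 0, t 1 0 / (1 + (‖t 1 0‖ : ℂ) ^ 2)] := by
  have hk := one_add_norm_sq_ne_zero (t 1 0)
  have hx := Complex.mul_conj' (t 1 0)
  simp only [coefZ1, nakDelta_of_mem_subFamily ht]
  obtain ⟨h1, h2, h3⟩ := ht
  generalize (‖t 1 0‖ : ℂ) ^ 2 = x at *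
  funext i
  fin_cases i <;> simp [h1, h2, h3, hx] <;> field_simp

theorem coefZbar_of_mem_subFamily {t : Param} (ht : t ∈ subFamily) :
    coefZbar t = ![0, (‖t 1 0‖ : ℂ) ^ 2 / (1 + (‖t 1 0‖ : ℂ) ^ 2),
      t 1 0 / (1 + (‖t 1 0‖ : ℂ) ^ 2), 0] := by
  have hx := Complex.mul_conj' (t 1 0)
  simp only [coefZbar, coefZ1_of_mem_subFamily ht]
  obtain ⟨h1, h2, h3⟩ := ht
  funext i
  fin_cases i <;> simp [h2, ← hx] <;> ring

theorem obstruction_of_mem_subFamily {t : Param} (ht : t ∈ subFamily) :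
    obstruction (coefZ1 t) (coefZbar t) * (1 + (‖t 1 0‖ : ℂ) ^ 2) ^ 2 =
      -((‖t 1 0‖ : ℂ) ^ 4 - 4 * (‖t 1 0‖ : ℂ) ^ 2 + 1) := by
  have hk := one_add_norm_sq_ne_zero (t 1 0)
  have hx := Complex.mul_conj' (t 1 0)
  rw [obstruction, coefZ1_of_mem_subFamily ht, coefZbar_of_mem_subFamily ht]
  simp only [Matrix.cons_val, map_div₀, map_sub, map_add, map_zero, map_one, map_pow,
    Complex.conj_ofReal]
  field_simp
  linear_combination 2 * hx

theorem admitsSKT_of_mem_subFamily {t : Param} (ht : t ∈ subFamily) (hta : t ∈ admissible)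
    (h : (‖t 1 0‖ ^ 2) ^ 2 - 4 * ‖t 1 0‖ ^ 2 + 1 = 0) :
    AdmitsSKT (Fin 3 → ℂ) (NakamuraManifold ⟨t, hta⟩) := by
  refine admitsSKT_of_obstruction_eq_zero ⟨t, hta⟩ ?_
  have h1 := obstruction_of_mem_subFamily ht
  have h2 : (‖t 1 0‖ : ℂ) ^ 4 - 4 * (‖t 1 0‖ : ℂ) ^ 2 + 1 = 0 := by
    rw [← Complex.ofReal_inj] at h
    push_cast at h
    linear_combination h
  rw [h2, neg_zero] at h1
  exact (mul_eq_zero.1 h1).resolve_right (pow_ne_zero _ (one_add_norm_sq_ne_zero _))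

theorem segment_zero_subset_subFamily {t : Param} (ht : t ∈ subFamily) (h : ‖t 1 0‖ ^ 2 < 1) :
    segment ℝ 0 t ⊆ subFamily ∩ admissible := by
  rintro s ⟨p, r, hp, hr, hpr, rfl⟩
  have hs : p • (0 : Param) + r • t ∈ subFamily := by
    obtain ⟨h1, h2, h3⟩ := ht
    refine ⟨?_, ?_, ?_⟩ <;> simp [h1, h2, h3]
  refine ⟨hs, mem_admissible_of_mem_subFamily hs ?_⟩
  have hn : ‖(p • (0 : Param) + r • t) 1 0‖ = r * ‖t 1 0‖ := by
    simp [abs_of_nonneg hr]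
  rw [hn, mul_pow]
  have hr1 : r ^ 2 ≤ 1 := by nlinarith
  nlinarith [sq_nonneg ‖t 1 0‖]

theorem first_circle {t : Param} (ht : t ∈ subFamily) (h : ‖t 1 0‖ ^ 2 = 2 - √3) :
    segment ℝ 0 t ⊆ subFamily ∩ admissible ∧
      ∃ ht : t ∈ admissible, AdmitsSKT (Fin 3 → ℂ) (NakamuraManifold ⟨t, ht⟩) := by
  have h3 : √3 ^ 2 = 3 := Real.sq_sqrt (by norm_num)
  have h4 : 1 < √3 := Real.lt_sqrt_of_sq_lt (by norm_num)
  have hs := segment_zero_subset_subFamily ht (by rw [h]; linarith)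
  refine ⟨hs, (hs (right_mem_segment ℝ 0 t)).2, admitsSKT_of_mem_subFamily ht _ ?_⟩
  rw [h]
  linear_combination h3

theorem second_circle {t : Param} (ht : t ∈ subFamily) (h : ‖t 1 0‖ ^ 2 = 2 + √3) :
    ∃ ht : t ∈ admissible, AdmitsSKT (Fin 3 → ℂ) (NakamuraManifold ⟨t, ht⟩) := by
  have h3 : √3 ^ 2 = 3 := Real.sq_sqrt (by norm_num)
  have h4 := Real.sqrt_nonneg 3
  refine ⟨mem_admissible_of_mem_subFamily ht (by rw [h]; linarith),
    admitsSKT_of_mem_subFamily ht _ ?_⟩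
  rw [h]
  linear_combination h3

/-! ### Integration over a fundamental domain -/

open MeasureTheory

instance : Countable latticeGamma := by
  have : Function.Injective fun (γ : latticeGamma) (i : Fin 3) => (γ.2 i).choose := by
    intro γ δ h
    apply Subtype.ext
    funext i
    have h1 := (γ.2 i).choose_spec
    have h2 := (δ.2 i).choose_spec
    rw [← h1, ← h2]
    exact congrArg _ (congrFun h i)
  have : Countable GaussianInt := by
    have : Function.Injective fun z : GaussianInt => (z.re, z.im) := by
      intro z w h
      exact Zsqrtd.ext (congrArg Prod.fst h) (congrArg Prod.snd h)
    exact this.countable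
  exact Function.Injective.countable ‹_›

/-- The real and imaginary parts of the coordinates lie in `[0, 1)`. -/
def unitCell : Set Heis := {z | ∀ i, 0 ≤ (z i).re ∧ (z i).re < 1 ∧ 0 ≤ (z i).im ∧ (z i).im < 1}

/-- The real and imaginary parts of the coordinates lie in `[0, 1]`. -/
def closedCell : Set Heis := {z | ∀ i, z i ∈ Set.Icc 0 1 ×ℂ Set.Icc 0 1}

theorem isCompact_closedCell : IsCompact closedCell := by
  have h : IsCompact (Set.Icc (0 : ℝ) 1 ×ℂ Set.Icc (0 : ℝ) 1) :=
    isCompact_Icc.reProdIm isCompact_Icc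
  have h2 := isCompact_univ_pi fun _ : Fin 3 => h
  have h3 : (Set.univ.pi fun _ : Fin 3 => Set.Icc (0 : ℝ) 1 ×ℂ Set.Icc (0 : ℝ) 1) = closedCell := by
    ext z
    simp [closedCell]
    rfl
  rwa [h3] at h2

theorem unitCell_subset : unitCell ⊆ closedCell := fun _ hz i =>
  ⟨⟨(hz i).1, (hz i).2.1.le⟩, ⟨(hz i).2.2.1, (hz i).2.2.2.le⟩⟩

/-- Each complex number is a unique Gaussian integer away from the unit square. -/
theorem existsUnique_gaussianInt (z : ℂ) :
    ∃! n : ℂ, n ∈ GaussianInt.toComplex.range ∧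
      0 ≤ (n + z).re ∧ (n + z).re < 1 ∧ 0 ≤ (n + z).im ∧ (n + z).im < 1 := by
  have hre : ∀ n : GaussianInt, (GaussianInt.toComplex n + z).re = n.re + z.re := fun n => by
    rw [Complex.add_re, GaussianInt.intCast_re]
  have him : ∀ n : GaussianInt, (GaussianInt.toComplex n + z).im = n.im + z.im := fun n => by
    rw [Complex.add_im, GaussianInt.intCast_im]
  refine ⟨GaussianInt.toComplex ⟨-⌊z.re⌋, -⌊z.im⌋⟩, ⟨⟨_, rfl⟩, ?_⟩, ?_⟩
  · have h1 := Int.floor_le z.re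
    have h2 := Int.lt_floor_add_one z.re
    have h3 := Int.floor_le z.im
    have h4 := Int.lt_floor_add_one z.im
    rw [hre, him]
    push_cast
    refine ⟨?_, ?_, ?_, ?_⟩ <;> linarith
  · rintro _ ⟨⟨n, rfl⟩, h⟩
    rw [hre, him] at h
    obtain ⟨h1, h2, h3, h4⟩ := h
    have e1 : ⌊z.re⌋ = -n.re := by
      rw [Int.floor_eq_iff]
      push_cast
      constructor <;> linarith
    have e2 : ⌊z.im⌋ = -n.im := by
      rw [Int.floor_eq_iff]
      push_cast
      constructor <;> linarith
    congr 1
    exact Zsqrtd.ext (by rw [e1, neg_neg]) (by rw [e2, neg_neg])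

/-- The unit cell is a fundamental domain for the left multiplications by the lattice. -/
theorem existsUnique_mem_unitCell (z : Heis) : ∃! γ : latticeGamma, (γ : Heis) * z ∈ unitCell := by
  obtain ⟨n0, ⟨h0, h0'⟩, u0⟩ := existsUnique_gaussianInt (z 0)
  obtain ⟨n1, ⟨h1, h1'⟩, u1⟩ := existsUnique_gaussianInt (z 1)
  obtain ⟨n2, ⟨h2, h2'⟩, u2⟩ := existsUnique_gaussianInt (z 2 + n0 * z 1)
  have hmem : (![n0, n1, n2] : Heis) ∈ latticeGamma := by
    intro i
    fin_cases i <;> assumption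
  refine ⟨⟨_, hmem⟩, ?_, ?_⟩
  · intro i
    fin_cases i
    · exact h0'
    · exact h1'
    · rw [← add_assoc] at h2'
      exact h2'
  · rintro ⟨γ, hγ⟩ h
    have e0 : γ 0 = n0 := u0 _ ⟨hγ 0, h 0⟩
    have e1 : γ 1 = n1 := u1 _ ⟨hγ 1, h 1⟩
    have e2 : γ 2 = n2 := by
      refine u2 _ ⟨hγ 2, ?_⟩
      have := h 2
      simp only [Heis.mul_two', e0] at this
      rwa [← add_assoc]
    exact Subtype.ext (Heis.ext e0 e1 e2)

/-- The shear `y ↦ (y₁ + c₁, y₂ + c₂, y₃ + h(y₁, y₂))` of `ℂ³` preserves the Lebesgue measure. -/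
theorem measurePreserving_shear (c : Fin 2 → ℂ) {h : (Fin 2 → ℂ) → ℂ} (hh : Measurable h) :
    MeasurePreserving (fun y : Fin 3 → ℂ =>
      (![y 0 + c 0, y 1 + c 1, y 2 + h ![y 0, y 1]] : Fin 3 → ℂ)) := by
  have he := volume_preserving_piFinSuccAbove (fun _ : Fin 3 => ℂ) 2
  have hs1 : MeasurePreserving (Prod.swap : ℂ × (Fin 2 → ℂ) → (Fin 2 → ℂ) × ℂ) :=
    Measure.measurePreserving_swap
  have hs2 : MeasurePreserving (Prod.swap : (Fin 2 → ℂ) × ℂ → ℂ × (Fin 2 → ℂ)) :=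
    Measure.measurePreserving_swap
  have hsk : MeasurePreserving fun p : (Fin 2 → ℂ) × ℂ => (p.1 + c, p.2 + h p.1) :=
    (measurePreserving_add_right volume c).skew_product (g := fun p q => q + h p)
      (measurable_snd.add (hh.comp measurable_fst))
      (Filter.Eventually.of_forall fun p => (measurePreserving_add_right volume (h p)).map_eq)
  have := (he.symm _).comp (hs2.comp (hsk.comp (hs1.comp he)))
  convert this using 1
  funext y i
  have h2 : ![y 0, y 1] = fun j => y (Fin.succAbove 2 j) := by
    funext j
    fin_cases j <;> rfl
  rw [h2]
  fin_cases i <;> rfl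

/-- The action of the lattice by left multiplications, in the coordinates `ζ^t`. -/
@[reducible] def nakAction (t : admissible) : MulAction latticeGamma (Fin 3 → ℂ) where
  smul γ y := nakLeft t γ y
  one_smul y := by
    change nakLeft t (1 : Heis) y = y
    rw [← nakZeta_nakZetaInv t.2 y, ← nakZeta_mul_eq_nakLeft, one_mul]
  mul_smul γ δ y := by
    change nakLeft t ((γ : Heis) * (δ : Heis)) y = nakLeft t γ (nakLeft t δ y)
    rw [← nakZeta_nakZetaInv t.2 y, ← nakZeta_mul_eq_nakLeft, ← nakZeta_mul_eq_nakLeft,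
      ← nakZeta_mul_eq_nakLeft, mul_assoc]

/-- The unit cell in the coordinates `ζ^t`. -/
def nakCell (t : Param) : Set (Fin 3 → ℂ) := nakZetaInv t ⁻¹' unitCell

theorem measurableSet_nakCell (t : Param) : MeasurableSet (nakCell t) := by
  have h : ∀ i, Continuous fun y => nakZetaInv t y i := fun i =>
    (Heis.continuous_coord i).comp (continuous_nakZetaInv t)
  have hre := fun i => (Complex.continuous_re.comp (h i)).measurable
  have him := fun i => (Complex.continuous_im.comp (h i)).measurable
  have : nakCell t = ⋂ i, {y | 0 ≤ (nakZetaInv t y i).re} ∩ ({y | (nakZetaInv t y i).re < 1} ∩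
      ({y | 0 ≤ (nakZetaInv t y i).im} ∩ {y | (nakZetaInv t y i).im < 1})) := by
    ext y
    simp [nakCell, unitCell]
  rw [this]
  exact MeasurableSet.iInter fun i => (measurableSet_le measurable_const (hre i)).inter
    ((measurableSet_lt (hre i) measurable_const).inter
      ((measurableSet_le measurable_const (him i)).inter
        (measurableSet_lt (him i) measurable_const)))

theorem nakCell_subset {t : Param} (ht : t ∈ admissible) :
    nakCell t ⊆ nakZeta t '' closedCell := fun y hy =>
  ⟨nakZetaInv t y, unitCell_subset hy, nakZeta_nakZetaInv ht y⟩

theorem isCompact_image_closedCell (t : Param) : IsCompact (nakZeta t '' closedCell) :=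
  isCompact_closedCell.image (continuous_nakZeta t)

theorem linForm_congr (a : Fin 4 → ℂ) {y z : Fin 3 → ℂ} (h0 : y 0 = z 0) (h1 : y 1 = z 1) :
    linForm a y = linForm a z := by
  rw [linForm_apply, linForm_apply, h0, h1]

theorem measurePreserving_nakLeft (t : Param) (w : Heis) : MeasurePreserving (nakLeft t w) := by
  have hh : Measurable fun p : Fin 2 → ℂ => nakShift t w 2 + w 0 * p 1
      + (t 1 0 * conj (w 0) + t 1 1 * conj (w 1)) * p 0 := by fun_prop
  have := measurePreserving_shear ![nakShift t w 0, nakShift t w 1] hh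
  convert this using 1
  funext y i
  fin_cases i
  · rfl
  · rfl
  · simp only [nakLeft, Matrix.cons_val]
    ring_nf

theorem isFundamentalDomain_nakCell (t : admissible) :
    letI := nakAction t
    IsFundamentalDomain latticeGamma (nakCell t) (volume : Measure (Fin 3 → ℂ)) := by
  let := nakAction t
  refine IsFundamentalDomain.mk' (measurableSet_nakCell t).nullMeasurableSet fun y => ?_
  have h : ∀ γ : latticeGamma, γ • y ∈ nakCell t ↔ (γ : Heis) * nakZetaInv t y ∈ unitCell := by
    intro γ
    change nakZetaInv t (nakLeft t γ y) ∈ unitCell ↔ _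
    rw [nakZetaInv_nakLeft t.2]
  simp only [h]
  exact existsUnique_mem_unitCell _

section Action

variable (t : admissible)

theorem smulInvariantMeasure_nakAction :
    letI := nakAction t
    SMulInvariantMeasure latticeGamma (Fin 3 → ℂ) volume :=
  letI := nakAction t
  ⟨fun γ _ hs => (measurePreserving_nakLeft t γ).measure_preimage hs.nullMeasurableSet⟩

theorem measurableConstSMul_nakAction :
    letI := nakAction t
    MeasurableConstSMul latticeGamma (Fin 3 → ℂ) :=
  letI := nakAction t
  ⟨fun γ => (measurePreserving_nakLeft t γ).measurable⟩

/-- The translates of the fundamental domain under the countable lattice cover `ℂ³`. -/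
theorem volume_nakCell_ne_zero : volume (nakCell t) ≠ 0 := by
  let := nakAction t
  have := smulInvariantMeasure_nakAction t
  have := measurableConstSMul_nakAction t
  exact (isFundamentalDomain_nakCell t).measure_ne_zero (NeZero.ne _)

/-- The integral of an invariant function over the fundamental domain does not change under a
measure preserving map which commutes with the lattice. -/
theorem setIntegral_nakCell_comp {f : (Fin 3 → ℂ) → ℂ} (hfc : Continuous f)
    (hf : ∀ (γ : latticeGamma) y, f (nakLeft t γ y) = f y) {R : (Fin 3 → ℂ) → Fin 3 → ℂ}
    (hR : MeasurePreserving R)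
    (hRc : ∀ (γ : latticeGamma) y, R (nakLeft t γ y) = nakLeft t γ (R y)) :
    ∫ y in nakCell t, f (R y) = ∫ y in nakCell t, f y := by
  let := nakAction t
  have := smulInvariantMeasure_nakAction t
  have := measurableConstSMul_nakAction t
  have hD := isFundamentalDomain_nakCell t
  have hD2 : IsFundamentalDomain latticeGamma (R ⁻¹' nakCell t)
      (volume : Measure (Fin 3 → ℂ)) :=
    hD.preimage_of_equiv hR.quasiMeasurePreserving (e := id) Function.bijective_id
      fun γ y => hRc γ y
  calc ∫ y in nakCell t, f (R y) = ∫ y in R ⁻¹' nakCell t, f (R y) :=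
        hD.setIntegral_eq hD2 fun γ y => by
          change f (R (nakLeft t γ y)) = _
          rw [hRc, hf]
    _ = ∫ y in nakCell t, f y := by
        rw [← setIntegral_map (measurableSet_nakCell t) hfc.aestronglyMeasurable
          hR.measurable.aemeasurable, hR.map_eq]

theorem integrableOn_nakCell {f : (Fin 3 → ℂ) → ℂ} (hf : Continuous f) :
    IntegrableOn f (nakCell t) :=
  (hf.continuousOn.integrableOn_compact (isCompact_image_closedCell t)).mono_set
    (nakCell_subset t.2)

end Action

/-- The vector field with the constant coefficients `c` in the frame dual to the coframe
`φ₁, φ₂, φ₃`, see `coframe`. -/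
def frame (a b : Fin 4 → ℂ) (c y : Fin 3 → ℂ) : Fin 3 → ℂ :=
  ![c 0, c 1, c 2 + linForm a y * c 1 + linForm b y * c 0]

/-- The flow of the vector field `frame a b c`. -/
def frameFlow (a b : Fin 4 → ℂ) (c : Fin 3 → ℂ) (s : ℝ) (y : Fin 3 → ℂ) : Fin 3 → ℂ :=
  ![y 0 + s * c 0, y 1 + s * c 1, y 2 + (s * (c 2 + linForm a y * c 1 + linForm b y * c 0)
    + s ^ 2 / 2 * (linForm a c * c 1 + linForm b c * c 0))]

theorem frameFlow_zero (a b : Fin 4 → ℂ) (c y : Fin 3 → ℂ) : frameFlow a b c 0 y = y := by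
  funext i
  fin_cases i <;> simp [frameFlow]

theorem linForm_frameFlow (a b d : Fin 4 → ℂ) (c : Fin 3 → ℂ) (s : ℝ) (y : Fin 3 → ℂ) :
    linForm d (frameFlow a b c s y) = linForm d y + s * linForm d c := by
  simp only [linForm_apply, frameFlow, Matrix.cons_val, map_add, map_mul, Complex.conj_ofReal]
  ring

theorem hasDerivAt_frameFlow (a b : Fin 4 → ℂ) (c y : Fin 3 → ℂ) (s : ℝ) :
    HasDerivAt (fun s => frameFlow a b c s y) (frame a b c (frameFlow a b c s y)) s := by
  have hs : HasDerivAt (fun s : ℝ => (s : ℂ)) 1 s := Complex.ofRealCLM.hasDerivAt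
  refine hasDerivAt_pi.2 fun i => ?_
  fin_cases i
  · simpa [frameFlow, frame] using (hs.mul_const (c 0)).const_add (y 0)
  · simpa [frameFlow, frame] using (hs.mul_const (c 1)).const_add (y 1)
  · have h := ((hs.mul_const (c 2 + linForm a y * c 1 + linForm b y * c 0)).add
      (((hs.pow 2).div_const 2).mul_const (linForm a c * c 1 + linForm b c * c 0))).const_add (y 2)
    refine HasDerivAt.congr_deriv h ?_
    simp only [frame, linForm_frameFlow]
    simp
    ring

theorem continuous_frameFlow (a b : Fin 4 → ℂ) (c : Fin 3 → ℂ) :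
    Continuous fun p : ℝ × (Fin 3 → ℂ) => frameFlow a b c p.1 p.2 := by
  refine continuous_pi fun i => ?_
  fin_cases i <;> simp only [frameFlow] <;> simp <;> fun_prop

theorem continuous_frame (a b : Fin 4 → ℂ) (c : Fin 3 → ℂ) : Continuous (frame a b c) := by
  refine continuous_pi fun i => ?_
  fin_cases i <;> simp only [frame] <;> simp <;> fun_prop

theorem measurePreserving_frameFlow (a b : Fin 4 → ℂ) (c : Fin 3 → ℂ) (s : ℝ) :
    MeasurePreserving (frameFlow a b c s) := by
  have hl : ∀ d : Fin 4 → ℂ, Measurable fun p : Fin 2 → ℂ => linForm d ![p 0, p 1, 0] := by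
    intro d
    simp only [linForm_apply, Matrix.cons_val]
    exact Continuous.measurable (by fun_prop)
  have hh : Measurable fun p : Fin 2 → ℂ =>
      (s * (c 2 + linForm a ![p 0, p 1, 0] * c 1 + linForm b ![p 0, p 1, 0] * c 0)
        + s ^ 2 / 2 * (linForm a c * c 1 + linForm b c * c 0) : ℂ) := by
    have h1 := hl a
    have h2 := hl b
    fun_prop
  have := measurePreserving_shear ![s * c 0, s * c 1] hh
  convert this using 1
  funext y i
  fin_cases i <;> rfl

theorem frameFlow_nakLeft (t : admissible) (c : Fin 3 → ℂ) (s : ℝ) (w : Heis)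
    (y : Fin 3 → ℂ) :
    frameFlow (coefZ1 t) (coefZbar t) c s (nakLeft t w y) =
      nakLeft t w (frameFlow (coefZ1 t) (coefZbar t) c s y) := by
  simp only [frameFlow, linForm_coefZ1_nakLeft t.2, linForm_coefZbar_nakLeft t.2]
  funext i
  fin_cases i <;> simp only [nakLeft] <;> simp <;> ring

/-- The derivative of an invariant function along a left invariant vector field has mean zero. -/
theorem setIntegral_fderiv_frame (t : admissible) {f : (Fin 3 → ℂ) → ℂ} (hfc : ContDiff ℝ 1 f)
    (hf : ∀ (γ : latticeGamma) y, f (nakLeft t γ y) = f y) (c : Fin 3 → ℂ) :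
    ∫ y in nakCell t, fderiv ℝ f y (frame (coefZ1 t) (coefZbar t) c y) = 0 := by
  set a := coefZ1 t
  set b := coefZbar t
  have hcont : Continuous fun p : ℝ × (Fin 3 → ℂ) =>
      fderiv ℝ f (frameFlow a b c p.1 p.2) (frame a b c (frameFlow a b c p.1 p.2)) :=
    ((hfc.continuous_fderiv (by simp)).comp (continuous_frameFlow a b c)).clm_apply
      ((continuous_frame a b c).comp (continuous_frameFlow a b c))
  obtain ⟨C, hC⟩ := ((isCompact_Icc (a := (-1 : ℝ)) (b := 1)).prod
    (isCompact_image_closedCell t)).exists_bound_of_continuousOn hcont.continuousOn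
  have hder := hasDerivAt_integral_of_dominated_loc_of_deriv_le
    (μ := volume.restrict (nakCell t)) (F := fun s y => f (frameFlow a b c s y))
    (F' := fun s y => fderiv ℝ f (frameFlow a b c s y) (frame a b c (frameFlow a b c s y)))
    (x₀ := (0 : ℝ)) (s := Set.Icc (-1) 1) (bound := fun _ => C)
    (Icc_mem_nhds (by norm_num) (by norm_num))
    (Filter.Eventually.of_forall fun s => (hfc.continuous.comp
      ((continuous_frameFlow a b c).comp (Continuous.prodMk_right s))).aestronglyMeasurable)
    (integrableOn_nakCell t (hfc.continuous.comp
      ((continuous_frameFlow a b c).comp (Continuous.prodMk_right 0))))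
    ((hcont.comp (Continuous.prodMk_right 0)).aestronglyMeasurable)
    ((ae_restrict_iff' (measurableSet_nakCell t)).2 (Filter.Eventually.of_forall
      fun y hy s hs => hC (s, y) ⟨hs, nakCell_subset t.2 hy⟩))
    (integrableOn_const ((measure_mono (nakCell_subset t.2)).trans_lt
      (isCompact_image_closedCell t).measure_lt_top).ne)
    (Filter.Eventually.of_forall fun y s _ =>
      ((hfc.differentiable (by simp)).differentiableAt.hasFDerivAt.comp_hasDerivAt s
        (hasDerivAt_frameFlow a b c y s)))
  have h1 : (fun s : ℝ => ∫ y in nakCell t, f (frameFlow a b c s y)) =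
      fun _ => ∫ y in nakCell t, f y := by
    funext s
    exact setIntegral_nakCell_comp t hfc.continuous hf (measurePreserving_frameFlow a b c s)
      fun γ y => frameFlow_nakLeft t c s γ y
  have h2 := hder.2
  rw [h1] at h2
  have h3 := h2.unique (hasDerivAt_const _ _)
  simpa only [frameFlow_zero] using h3

/-! ### The mean of an exterior derivative -/

section Mean

open MeasureTheory

theorem ContDiff.continuousMultilinearMap_apply_pi {X E F : Type*} [NormedAddCommGroup X]
    [NormedSpace ℝ X] [NormedAddCommGroup E] [NormedSpace ℝ E] [NormedAddCommGroup F]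
    [NormedSpace ℝ F] {m : ℕ∞ω} {n : ℕ} {α : X → E [×n]→L[ℝ] F} {V : Fin n → X → E}
    (hα : ContDiff ℝ m α) (hV : ∀ i, ContDiff ℝ m (V i)) :
    ContDiff ℝ m fun x => α x fun i => V i x := by
  induction n with
  | zero =>
    have h := (ContinuousMultilinearMap.apply ℝ (fun _ : Fin 0 => E) F 0).contDiff.comp hα
    convert h using 1
    funext x
    simp only [Function.comp_apply, ContinuousMultilinearMap.apply_apply]
    congr 1
    exact Subsingleton.elim _ _
  | succ n ih =>
    let L : (E [×(n + 1)]→L[ℝ] F) →L[ℝ] E →L[ℝ] E [×n]→L[ℝ] F :=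
      (continuousMultilinearCurryLeftEquiv ℝ (fun _ : Fin (n + 1) => E) F :
        (E [×(n + 1)]→L[ℝ] F) →L[ℝ] E →L[ℝ] E [×n]→L[ℝ] F)
    have h : ContDiff ℝ m fun x => L (α x) := contDiff_const.clm_apply hα
    have h2 := ih (h.clm_apply (hV 0)) (V := fun i => V i.succ) fun i => hV _
    convert h2 using 1
    funext x
    change α x _ = α x _
    congr 1
    funext i
    refine Fin.cases ?_ (fun j => ?_) i <;> simp

theorem ContDiff.continuousAlternatingMap_apply_pi {X E F : Type*} [NormedAddCommGroup X]
    [NormedSpace ℝ X] [NormedAddCommGroup E] [NormedSpace ℝ E] [NormedAddCommGroup F]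
    [NormedSpace ℝ F] {m : ℕ∞ω} {n : ℕ} {α : X → E [⋀^Fin n]→L[ℝ] F} {V : Fin n → X → E}
    (hα : ContDiff ℝ m α) (hV : ∀ i, ContDiff ℝ m (V i)) :
    ContDiff ℝ m fun x => α x fun i => V i x := by
  have h := (ContinuousAlternatingMap.toContinuousMultilinearMapLI (𝕜 := ℝ) (E := E) (F := F)
    (ι := Fin n)).contDiff.comp hα
  exact h.continuousMultilinearMap_apply_pi hV

/-- The multiples of the third vector of the frame. -/
def vec3 (l : ℂ) : Fin 3 → ℂ := ![0, 0, l]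

theorem vec3_zero : vec3 0 = 0 := by
  funext i
  fin_cases i <;> rfl

theorem frame_vec3 (a b : Fin 4 → ℂ) (l : ℂ) (y : Fin 3 → ℂ) : frame a b (vec3 l) y = vec3 l := by
  funext i
  fin_cases i <;> simp [frame, vec3]

theorem frame_smul (a b : Fin 4 → ℂ) (l : ℂ) (c y : Fin 3 → ℂ) :
    frame a b (l • c) y = l • frame a b c y := by
  funext i
  fin_cases i
  · rfl
  · rfl
  · simp [frame]
    ring

theorem contDiff_frame (a b : Fin 4 → ℂ) (c : Fin 3 → ℂ) : ContDiff ℝ ∞ (frame a b c) := by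
  refine contDiff_pi.2 fun i => ?_
  fin_cases i
  · exact contDiff_const
  · exact contDiff_const
  · exact (contDiff_const.add ((linForm a).contDiff.mul contDiff_const)).add
      ((linForm b).contDiff.mul contDiff_const)

theorem fderiv_frame (a b : Fin 4 → ℂ) (c y u : Fin 3 → ℂ) :
    fderiv ℝ (frame a b c) y u = vec3 (linForm a u * c 1 + linForm b u * c 0) := by
  have h : HasFDerivAt (frame a b c)
      (ContinuousLinearMap.pi ![0, 0, c 1 • linForm a + c 0 • linForm b]) y := by
    refine hasFDerivAt_pi'.2 fun i => ?_
    fin_cases i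
    · exact hasFDerivAt_const _ _
    · exact hasFDerivAt_const _ _
    · exact (((linForm a).hasFDerivAt.mul_const (c 1)).const_add (c 2)).add
        ((linForm b).hasFDerivAt.mul_const (c 0))
  rw [h.fderiv]
  funext i
  fin_cases i
  · rfl
  · rfl
  · change c 1 * linForm a u + c 0 * linForm b u = linForm a u * c 1 + linForm b u * c 0
    ring

theorem linForm_frame (a b d : Fin 4 → ℂ) (c y : Fin 3 → ℂ) :
    linForm d (frame a b c y) = linForm d c := linForm_congr d rfl rfl

/-- The structure equations of the frame, dual to those of the coframe. -/
theorem lieBracket_frame (a b : Fin 4 → ℂ) (c d y : Fin 3 → ℂ) :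
    VectorField.lieBracket ℝ (frame a b c) (frame a b d) y =
      vec3 (-(torsion20 a b c d + torsion11 a b c d)) := by
  rw [VectorField.lieBracket, fderiv_frame, fderiv_frame, linForm_frame, linForm_frame,
    linForm_frame, linForm_frame, ← torsion_eq]
  funext i
  fin_cases i
  · simp [vec3]
  · simp [vec3]
  · change linForm a c * d 1 + linForm b c * d 0 - (linForm a d * c 1 + linForm b d * c 0) =
      -(linForm a d * c 1 + linForm b d * c 0 - linForm a c * d 1 - linForm b c * d 0)
    ring

variable (t : admissible)

theorem frame_nakLeft (w : Heis) (c y : Fin 3 → ℂ) :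
    frame (coefZ1 t) (coefZbar t) c (nakLeft t w y) =
      fderiv ℝ (nakLeft t w) y (frame (coefZ1 t) (coefZbar t) c y) := by
  rw [fderiv_nakLeft]
  funext i
  fin_cases i
  · rfl
  · rfl
  · simp only [frame, linForm_coefZ1_nakLeft t.2, linForm_coefZbar_nakLeft t.2]
    change c 2 + _ * c 1 + _ * c 0 = c 2 + _ * c 1 + _ * c 0 + w 0 * c 1 + _ * c 0
    ring

/-- A form on `ℂ³` is the lift of a form on `M_t` if it is invariant under the lattice. -/
def IsLatticeInvariant {k : ℕ} (α : (Fin 3 → ℂ) → (Fin 3 → ℂ) [⋀^Fin k]→L[ℝ] ℂ) : Prop :=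
  ∀ (γ : latticeGamma) (y : Fin 3 → ℂ),
    (α (nakLeft t γ y)).compContinuousLinearMap (fderiv ℝ (nakLeft t γ) y) = α y

/-- On left invariant vector fields, the mean of the exterior derivative of a form on `M_t` is given
by the formula for left invariant forms: the derivatives of the coefficients do not
contribute. -/
theorem setIntegral_extDeriv_frame {n : ℕ}
    {α : (Fin 3 → ℂ) → (Fin 3 → ℂ) [⋀^Fin (n + 1)]→L[ℝ] ℂ} (hα : ContDiff ℝ 1 α)
    (hinv : IsLatticeInvariant t α) (c : Fin (n + 2) → Fin 3 → ℂ) :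
    let V := fun i => frame (coefZ1 t) (coefZbar t) (c i)
    ∫ y in nakCell t, extDeriv α y (fun i => V i y) =
      ∑ i : Fin (n + 1), ∑ j ≥ i, (-1) ^ (i + j + 1 : ℕ) * ∫ y in nakCell t, α y
        (Matrix.vecCons (vec3 (-(torsion20 (coefZ1 t) (coefZbar t) (c i.castSucc) (c j.succ)
          + torsion11 (coefZ1 t) (coefZbar t) (c i.castSucc) (c j.succ))))
          (j.removeNth (i.castSucc.removeNth fun i => V i y))) := by
  intro V
  have hV : ∀ i, ContDiff ℝ ∞ (V i) := fun i => contDiff_frame _ _ _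
  have hcoef : ∀ i : Fin (n + 2), ContDiff ℝ 1 fun y => α y (i.removeNth fun i => V i y) :=
    fun i => hα.continuousAlternatingMap_apply_pi (V := i.removeNth V)
      fun j => (hV _).of_le (by simp)
  have hcinv : ∀ (i : Fin (n + 2)) (γ : latticeGamma) y,
      α (nakLeft t γ y) (i.removeNth fun i => V i (nakLeft t γ y)) =
        α y (i.removeNth fun i => V i y) := by
    intro i γ y
    conv_rhs => rw [← hinv γ y]
    rw [ContinuousAlternatingMap.compContinuousLinearMap_apply]
    congr 1
    funext j
    exact frame_nakLeft t γ _ y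
  have hb : ∀ (i j : Fin (n + 1)), Continuous fun y => α y
      (Matrix.vecCons (vec3 (-(torsion20 (coefZ1 t) (coefZbar t) (c i.castSucc) (c j.succ)
        + torsion11 (coefZ1 t) (coefZbar t) (c i.castSucc) (c j.succ))))
        (j.removeNth (i.castSucc.removeNth fun i => V i y))) := by
    intro i j
    refine (hα.continuousAlternatingMap_apply_pi (V := Matrix.vecCons (fun _ =>
      vec3 (-(torsion20 (coefZ1 t) (coefZbar t) (c i.castSucc) (c j.succ)
        + torsion11 (coefZ1 t) (coefZbar t) (c i.castSucc) (c j.succ))))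
      (j.removeNth (i.castSucc.removeNth V))) fun k => ?_).continuous.congr fun y => ?_
    · refine Fin.cases ?_ (fun k => ?_) k
      · exact contDiff_const
      · exact (hV _).of_le (by simp)
    · congr 1
      funext k
      refine Fin.cases ?_ (fun k => ?_) k <;> rfl
  have hform : ∀ y, extDeriv α y (fun i => V i y) =
      (∑ i, (-1) ^ i.val * fderiv ℝ (fun y => α y (i.removeNth fun i => V i y)) y (V i y)) +
        ∑ i : Fin (n + 1), ∑ j ≥ i, (-1) ^ (i + j + 1 : ℕ) * α y
        (Matrix.vecCons (vec3 (-(torsion20 (coefZ1 t) (coefZbar t) (c i.castSucc) (c j.succ)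
          + torsion11 (coefZ1 t) (coefZbar t) (c i.castSucc) (c j.succ))))
          (j.removeNth (i.castSucc.removeNth fun i => V i y))) := by
    intro y
    rw [extDeriv_apply_vectorField (hα.differentiable (by simp)).differentiableAt
      fun i => ((hV i).differentiable (by simp)).differentiableAt, sub_eq_add_neg,
      ← Finset.sum_neg_distrib]
    congr 1
    · simp
    · refine Finset.sum_congr rfl fun i _ => ?_
      rw [← Finset.sum_neg_distrib]
      refine Finset.sum_congr rfl fun j _ => ?_
      rw [lieBracket_frame]
      simp [pow_succ]
  simp only [hform]
  have hint : ∀ i : Fin (n + 2), Continuous fun y =>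
      fderiv ℝ (fun y => α y (i.removeNth fun i => V i y)) y (V i y) := fun i =>
    ((hcoef i).continuous_fderiv (by simp)).clm_apply (hV i).continuous
  rw [integral_add, integral_finsetSum, Finset.sum_eq_zero, zero_add, integral_finsetSum]
  · refine Finset.sum_congr rfl fun i _ => ?_
    rw [integral_finsetSum]
    · exact Finset.sum_congr rfl fun j _ => integral_const_mul _ _
    · exact fun j _ => (integrableOn_nakCell t (hb i j)).const_mul _
  · exact fun i _ => integrable_finsetSum _ fun j _ =>
      (integrableOn_nakCell t (hb i j)).const_mul _
  · intro i _
    rw [integral_const_mul, setIntegral_fderiv_frame t (hcoef i) (hcinv i), mul_zero]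
  · exact fun i _ => (integrableOn_nakCell t (hint i)).const_mul _
  · exact integrable_finsetSum _ fun i _ => (integrableOn_nakCell t (hint i)).const_mul _
  · exact integrable_finsetSum _ fun i _ => integrable_finsetSum _ fun j _ =>
      (integrableOn_nakCell t (hb i j)).const_mul _

end Mean

/-! ### The obstruction to SKT metrics -/

section Obstruction

/-- On a complex line, a Hermitian metric is determined by the length of one vector. -/
theorem apply_smul_smul_self {E : Type*} [NormedAddCommGroup E] [NormedSpace ℂ E]
    {g : E →L[ℝ] E →L[ℝ] ℝ} (hs : ∀ v w, g v w = g w v)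
    (hJ : ∀ v w, g (Complex.I • v) (Complex.I • w) = g v w) (c d : ℂ) (v : E) :
    g (c • v) (d • v) = (c * conj d).re * g v v := by
  have hc : ∀ c : ℂ, c • v = (c.re : ℝ) • v + (c.im : ℝ) • Complex.I • v := by
    intro c
    conv_lhs => rw [← Complex.re_add_im c]
    rw [add_smul, mul_smul]
    rfl
  have h1 : g v (Complex.I • v) = -g (Complex.I • v) v := by
    rw [← hJ v, smul_smul]
    simp
  have h2 : g (Complex.I • v) v = 0 := by
    have := hs v (Complex.I • v)
    linarith
  rw [h2, neg_zero] at h1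
  rw [hc c, hc d]
  simp only [map_add, map_smul, add_apply, smul_apply, hJ, h1, h2, smul_eq_mul, Complex.mul_re,
    Complex.conj_re, Complex.conj_im]
  ring

/-- A form of type `(1, 3)` vanishes on a pair of complex lines, on which only the component of type
`(2, 2)` is not zero. -/
theorem IsOfType.apply_complex_lines_eq_zero {E : Type*} [NormedAddCommGroup E] [NormedSpace ℂ E]
    {γ : E [⋀^Fin 4]→L[ℝ] ℂ} (h : IsOfType 1 3 γ) (p q : E) :
    γ ![p, Complex.I • p, q, Complex.I • q] = 0 := by
  have hneg : γ ![Complex.I • p, -p, Complex.I • q, -q] =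
      γ ![Complex.I • p, p, Complex.I • q, q] := by
    have h1 := γ.map_update_neg ![Complex.I • p, p, Complex.I • q, -q] 1 p
    have h2 := γ.map_update_neg ![Complex.I • p, p, Complex.I • q, q] 3 q
    have e1 : Function.update ![Complex.I • p, p, Complex.I • q, -q] 1 (-p) =
        ![Complex.I • p, -p, Complex.I • q, -q] := by
      funext i; fin_cases i <;> rfl
    have e2 : Function.update ![Complex.I • p, p, Complex.I • q, q] 3 (-q) =
        ![Complex.I • p, p, Complex.I • q, -q] := by
      funext i; fin_cases i <;> rfl
    have e3 : Function.update ![Complex.I • p, p, Complex.I • q, -q] 1 p =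
        ![Complex.I • p, p, Complex.I • q, -q] := by
      funext i; fin_cases i <;> rfl
    have e4 : Function.update ![Complex.I • p, p, Complex.I • q, q] 3 q =
        ![Complex.I • p, p, Complex.I • q, q] := by
      funext i; fin_cases i <;> rfl
    rw [e1, e3] at h1
    rw [e2, e4] at h2
    exact h1.trans (neg_eq_iff_eq_neg.2 h2)
  have hswap : γ ![Complex.I • p, p, Complex.I • q, q] =
      γ ![p, Complex.I • p, q, Complex.I • q] := by
    have h1 := γ.map_swap ![p, Complex.I • p, q, Complex.I • q] (show (0 : Fin 4) ≠ 1 by decide)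
    have h2 := γ.map_swap ![Complex.I • p, p, q, Complex.I • q] (show (2 : Fin 4) ≠ 3 by decide)
    have e1 : ![p, Complex.I • p, q, Complex.I • q] ∘ Equiv.swap (0 : Fin 4) 1 =
        ![Complex.I • p, p, q, Complex.I • q] := by
      funext i; fin_cases i <;> rfl
    have e2 : ![Complex.I • p, p, q, Complex.I • q] ∘ Equiv.swap (2 : Fin 4) 3 =
        ![Complex.I • p, p, Complex.I • q, q] := by
      funext i; fin_cases i <;> rfl
    rw [e1] at h1
    rw [e2, h1, neg_neg] at h2
    exact h2
  have hI := h Complex.I ![p, Complex.I • p, q, Complex.I • q]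
  have e : (fun i => Complex.I • ![p, Complex.I • p, q, Complex.I • q] i) =
      ![Complex.I • p, -p, Complex.I • q, -q] := by
    funext i; fin_cases i <;> simp [smul_smul]
  have hc : Complex.I ^ 1 * conj Complex.I ^ 3 = -1 := by
    rw [Complex.conj_I, pow_one]
    linear_combination (1 - Complex.I ^ 2) * Complex.I_sq
  rw [e, hneg, hswap, hc] at hI
  linear_combination (1 / 2 : ℂ) * hI

theorem vec3_smul (l : ℂ) : l • vec3 1 = vec3 l := by
  funext i
  fin_cases i <;> simp [vec3]

theorem sum_pairs_two (f : Fin 2 → Fin 2 → ℂ) : ∑ i, ∑ j ≥ i, f i j = f 0 0 + f 0 1 + f 1 1 := by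
  have h1 : Finset.Ici (1 : Fin 2) = {1} := by decide
  simp [Fin.sum_univ_two, h1]

theorem sum_pairs_three (f : Fin 3 → Fin 3 → ℂ) : ∑ i, ∑ j ≥ i, f i j =
    f 0 0 + f 0 1 + f 0 2 + (f 1 1 + f 1 2) + f 2 2 := by
  have h1 : Finset.Ici (1 : Fin 3) = {1, 2} := by decide
  have h2 : Finset.Ici (2 : Fin 3) = {2} := by decide
  simp [Fin.sum_univ_three, h1, h2]

variable {t : admissible} {g : (Fin 3 → ℂ) → (Fin 3 → ℂ) →L[ℝ] (Fin 3 → ℂ) →L[ℝ] ℝ}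

namespace IsInvariantSKT

theorem contDiff_fundamentalForm (hg : IsInvariantSKT latticeGamma (nakChart t) g) :
    ContDiff ℝ ∞ fun y => fundamentalForm (g y) :=
  contDiff_iff_contDiffAt.2 fun _ => contDiffAt_fundamentalForm hg.contDiff.contDiffAt

theorem isLatticeInvariant_fundamentalForm (hg : IsInvariantSKT latticeGamma (nakChart t) g) :
    IsLatticeInvariant t fun y => fundamentalForm (g y) := by
  intro γ y
  have hL : ∀ v, fderiv ℝ (nakLeft t γ) y (Complex.I • v) =
      Complex.I • fderiv ℝ (nakLeft t γ) y v := by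
    intro v
    rw [((contDiff_nakLeft t γ).differentiable (by simp) y).fderiv_restrictScalars ℝ]
    exact map_smul (fderiv ℂ (nakLeft t γ) y) _ _
  rw [← fundamentalForm_bilinearComp _ _ hL]
  congr 1
  ext v w
  have := hg.deck_eq γ y v w
  rwa [deck_nakChart] at this

theorem isLatticeInvariant_dbar (hg : IsInvariantSKT latticeGamma (nakChart t) g) :
    IsLatticeInvariant t (dbar fun y => fundamentalForm (g y)) := by
  intro γ y
  rw [← dbar_pullback (hg.contDiff_fundamentalForm.differentiable (by simp) _)
    (contDiff_nakLeft t γ).contDiffAt]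
  congr 1
  funext x
  exact hg.isLatticeInvariant_fundamentalForm γ x

theorem contDiff_dbar (hg : IsInvariantSKT latticeGamma (nakChart t) g) :
    ContDiff ℝ ∞ (dbar fun y => fundamentalForm (g y)) :=
  contDiff_iff_contDiffAt.2 fun _ => contDiffAt_dbar hg.contDiff_fundamentalForm.contDiffAt

/-- The mean of `dω` on left invariant fields, one of which is a multiple of the third vector of the
frame. -/
theorem setIntegral_extDeriv_vec3 (hg : IsInvariantSKT latticeGamma (nakChart t) g) (l : ℂ)
    (c d : Fin 3 → ℂ) :
    ∫ y in nakCell t, extDeriv (fun y => fundamentalForm (g y)) y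
        ![vec3 l, frame (coefZ1 t) (coefZbar t) c y, frame (coefZ1 t) (coefZbar t) d y] =
      -((torsion20 (coefZ1 t) (coefZbar t) c d + torsion11 (coefZ1 t) (coefZbar t) c d)
          * conj l).im * ∫ y in nakCell t, (g y (vec3 1) (vec3 1) : ℂ) := by
  have h := setIntegral_extDeriv_frame t (hg.contDiff_fundamentalForm.of_le (by simp))
    hg.isLatticeInvariant_fundamentalForm ![vec3 l, c, d]
  dsimp only at h
  have e : ∀ y, (fun i => frame (coefZ1 t) (coefZbar t) (![vec3 l, c, d] i) y) =
      ![vec3 l, frame (coefZ1 t) (coefZbar t) c y, frame (coefZ1 t) (coefZbar t) d y] := by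
    intro y
    funext i
    fin_cases i
    · exact frame_vec3 _ _ _ _
    · rfl
    · rfl
  simp only [e] at h
  rw [h, sum_pairs_two]
  have hform : ∀ y (m : ℂ) (w : Fin 1 → Fin 3 → ℂ), w 0 = vec3 l →
      fundamentalForm (g y) (Matrix.vecCons (vec3 m) w) =
        -(m * conj l).im * (g y (vec3 1) (vec3 1) : ℂ) := by
    intro y m w hw
    have hw2 : w = ![vec3 l] := by
      funext i
      fin_cases i
      exact hw
    rw [hw2, fundamentalForm_apply _ (hg.symm y) (hg.invariant y), ← vec3_smul m, ← vec3_smul l,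
      smul_smul, apply_smul_smul_self (hg.symm y) (hg.invariant y)]
    rw [mul_assoc, Complex.I_mul_re]
    push_cast
    rfl
  have h0 : ∀ u : Fin 3 → ℂ, torsion20 (coefZ1 t) (coefZbar t) (vec3 l) u
      + torsion11 (coefZ1 t) (coefZbar t) (vec3 l) u = 0 := by
    intro u
    simp [torsion20, torsion11, vec3]
  have hzero : ∀ y (w : Fin 1 → Fin 3 → ℂ),
      fundamentalForm (g y) (Matrix.vecCons (vec3 (-0)) w) = 0 := by
    intro y w
    rw [neg_zero, vec3_zero]
    exact (fundamentalForm (g y)).map_coord_zero 0 rfl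
  have hlast : ∀ y (m : ℂ), fundamentalForm (g y) (Matrix.vecCons (vec3 m)
      (Fin.removeNth 1 ((Fin.castSucc 1).removeNth ![vec3 l, frame (coefZ1 t) (coefZbar t) c y,
        frame (coefZ1 t) (coefZbar t) d y]))) = _ := fun y m => hform y m _ rfl
  have hc0 : ![vec3 l, c, d] (Fin.castSucc 0) = vec3 l := rfl
  have hc1 : ![vec3 l, c, d] (Fin.castSucc 1) = c := rfl
  have hd : ![vec3 l, c, d] (Fin.succ 1) = d := rfl
  simp only [hlast, hc0, hc1, hd, h0, hzero, integral_zero, mul_zero, zero_add, neg_mul,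
    Complex.neg_im, Complex.ofReal_neg, neg_neg]
  rw [integral_const_mul]
  simp [pow_succ]

/-- The mean of `∂̄ ω` on left invariant fields, one of which is a multiple of the third vector of
the frame. -/
theorem setIntegral_dbar_vec3 (hg : IsInvariantSKT latticeGamma (nakChart t) g) (l : ℂ)
    (c : Fin 2 → Fin 3 → ℂ) :
    ∫ y in nakCell t, dbar (fun y => fundamentalForm (g y)) y
        (Matrix.vecCons (vec3 l) fun i => frame (coefZ1 t) (coefZbar t) (c i) y) =
      Complex.I / 2 * (∫ y in nakCell t, (g y (vec3 1) (vec3 1) : ℂ)) *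
        (torsion11 (coefZ1 t) (coefZbar t) (c 0) (c 1) * conj l
          - conj (torsion20 (coefZ1 t) (coefZbar t) (c 0) (c 1)) * l) := by
  have e : ∀ y, dbar (fun y => fundamentalForm (g y)) y
      (Matrix.vecCons (vec3 l) fun i => frame (coefZ1 t) (coefZbar t) (c i) y) =
      1 / 2 * extDeriv (fun y => fundamentalForm (g y)) y ![vec3 l,
        frame (coefZ1 t) (coefZbar t) (c 0) y, frame (coefZ1 t) (coefZbar t) (c 1) y]
      + Complex.I / 2 * extDeriv (fun y => fundamentalForm (g y)) y ![vec3 (Complex.I * l),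
        frame (coefZ1 t) (coefZbar t) (Complex.I • c 0) y,
        frame (coefZ1 t) (coefZbar t) (Complex.I • c 1) y] := by
    intro y
    have e1 : (Matrix.vecCons (vec3 l) fun i => frame (coefZ1 t) (coefZbar t) (c i) y) =
        ![vec3 l, frame (coefZ1 t) (coefZbar t) (c 0) y,
          frame (coefZ1 t) (coefZbar t) (c 1) y] := by
      funext i
      fin_cases i <;> rfl
    have e2 : (fun i => Complex.I • (![vec3 l, frame (coefZ1 t) (coefZbar t) (c 0) y,
          frame (coefZ1 t) (coefZbar t) (c 1) y] : Fin 3 → Fin 3 → ℂ) i) =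
        ![vec3 (Complex.I * l), frame (coefZ1 t) (coefZbar t) (Complex.I • c 0) y,
          frame (coefZ1 t) (coefZbar t) (Complex.I • c 1) y] := by
      funext i
      fin_cases i
      · change Complex.I • vec3 l = vec3 (Complex.I * l)
        rw [← vec3_smul, ← vec3_smul (Complex.I * l), smul_smul]
      · exact (frame_smul _ _ _ _ _).symm
      · exact (frame_smul _ _ _ _ _).symm
    rw [dbar_apply, e1, e2]
    ring
  have hcont : ∀ (l : ℂ) (c d : Fin 3 → ℂ), Continuous fun y =>
      extDeriv (fun y => fundamentalForm (g y)) y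
        ![vec3 l, frame (coefZ1 t) (coefZbar t) c y, frame (coefZ1 t) (coefZbar t) d y] := by
    intro l c d
    have h1 : ContDiff ℝ ∞ (extDeriv fun y => fundamentalForm (g y)) :=
      contDiff_iff_contDiffAt.2 fun _ => hg.contDiff_fundamentalForm.contDiffAt.extDeriv_of_top
    have h2 := h1.continuousAlternatingMap_apply_pi (V := ![fun _ => vec3 l,
      frame (coefZ1 t) (coefZbar t) c, frame (coefZ1 t) (coefZbar t) d]) fun i => by
        fin_cases i
        · exact contDiff_const
        · exact contDiff_frame _ _ _
        · exact contDiff_frame _ _ _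
    refine h2.continuous.congr fun y => ?_
    congr 1
    funext i
    fin_cases i <;> rfl
  simp only [e]
  rw [integral_add ((integrableOn_nakCell t (hcont _ _ _)).const_mul _)
    ((integrableOn_nakCell t (hcont _ _ _)).const_mul _), integral_const_mul, integral_const_mul,
    hg.setIntegral_extDeriv_vec3, hg.setIntegral_extDeriv_vec3, torsion20_smul_I,
    torsion11_smul_I]
  generalize torsion20 (coefZ1 t) (coefZbar t) (c 0) (c 1) = p
  generalize torsion11 (coefZ1 t) (coefZbar t) (c 0) (c 1) = q
  generalize ∫ y in nakCell t, (g y (vec3 1) (vec3 1) : ℂ) = m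
  have h : 1 / 2 * (-((p + q) * conj l).im : ℂ)
      + Complex.I / 2 * (-((-p + q) * conj (Complex.I * l)).im : ℂ) =
      Complex.I / 2 * (q * conj l - conj p * l) := by
    apply Complex.ext <;> simp <;> ring
  linear_combination m * h

/-- The mean of the squared length of the third vector of the frame is positive. -/
theorem setIntegral_ne_zero (hg : IsInvariantSKT latticeGamma (nakChart t) g) :
    ∫ y in nakCell t, (g y (vec3 1) (vec3 1) : ℂ) ≠ 0 := by
  have hpos : ∀ y, 0 < g y (vec3 1) (vec3 1) := fun y =>
    hg.pos y _ fun h => one_ne_zero (congrFun h 2)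
  have hcont : Continuous fun y => g y (vec3 1) (vec3 1) :=
    (hg.contDiff.continuous.clm_apply continuous_const).clm_apply continuous_const
  have hint : IntegrableOn (fun y => g y (vec3 1) (vec3 1)) (nakCell t) := by
    have := (integrableOn_nakCell t (Complex.continuous_ofReal.comp hcont)).re
    exact this
  rw [integral_complex_ofReal, Complex.ofReal_ne_zero]
  refine ((setIntegral_pos_iff_support_of_nonneg_ae (Filter.Eventually.of_forall
    fun y => (hpos y).le) hint).2 ?_).ne'
  have : Function.support (fun y => g y (vec3 1) (vec3 1)) = Set.univ :=
    Set.eq_univ_of_forall fun y => (hpos y).ne'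
  rw [this, Set.univ_inter]
  exact pos_iff_ne_zero.2 (volume_nakCell_ne_zero t)

/-- The mean of `d ∂̄ ω` on the frame `e₁, i e₁, e₂, i e₂` is zero by type, and it is a nonzero
multiple of the number `κ`. -/
theorem obstruction_eq_zero (hg : IsInvariantSKT latticeGamma (nakChart t) g) :
    obstruction (coefZ1 t) (coefZbar t) = 0 := by
  let c : Fin 4 → Fin 3 → ℂ :=
    ![![1, 0, 0], Complex.I • ![1, 0, 0], ![0, 1, 0], Complex.I • ![0, 1, 0]]
  have h := setIntegral_extDeriv_frame t (hg.contDiff_dbar.of_le (by simp))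
    hg.isLatticeInvariant_dbar c
  dsimp only at h
  have hzero : ∀ y, extDeriv (dbar fun y => fundamentalForm (g y)) y
      (fun i => frame (coefZ1 t) (coefZbar t) (c i) y) = 0 := by
    intro y
    rw [← (hg.isOfType y).apply_complex_lines_eq_zero (frame (coefZ1 t) (coefZbar t) ![1, 0, 0] y)
      (frame (coefZ1 t) (coefZbar t) ![0, 1, 0] y), ← frame_smul, ← frame_smul]
    congr 1
    funext i
    fin_cases i <;> rfl
  have hterm : ∀ (l : ℂ) (i j : Fin 3), ∫ y in nakCell t, dbar (fun y => fundamentalForm (g y)) y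
        (Matrix.vecCons (vec3 l)
          (j.removeNth (i.castSucc.removeNth fun i => frame (coefZ1 t) (coefZbar t) (c i) y))) =
          _ :=
    fun l i j => hg.setIntegral_dbar_vec3 l (j.removeNth (i.castSucc.removeNth c))
  simp only [hzero, hterm, integral_zero] at h
  have hne := hg.setIntegral_ne_zero
  generalize ∫ y in nakCell t, (g y (vec3 1) (vec3 1) : ℂ) = m at h hne
  rw [sum_pairs_three] at h
  -- the term in which the fields `i` and `j` are replaced by their bracket
  let q (i j k l : Fin 4) : ℂ :=
    torsion11 (coefZ1 t) (coefZbar t) (c k) (c l) *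
      conj (-(torsion20 (coefZ1 t) (coefZbar t) (c i) (c j)
        + torsion11 (coefZ1 t) (coefZbar t) (c i) (c j)))
      - conj (torsion20 (coefZ1 t) (coefZbar t) (c k) (c l)) *
        -(torsion20 (coefZ1 t) (coefZbar t) (c i) (c j)
          + torsion11 (coefZ1 t) (coefZbar t) (c i) (c j))
  change 0 = (-1) ^ 1 * (Complex.I / 2 * m * q 0 1 2 3) + (-1) ^ 2 * (Complex.I / 2 * m * q 0 2 1 3)
    + (-1) ^ 3 * (Complex.I / 2 * m * q 0 3 1 2) + ((-1) ^ 3 * (Complex.I / 2 * m * q 1 2 0 3)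
    + (-1) ^ 4 * (Complex.I / 2 * m * q 1 3 0 2)) + (-1) ^ 5 * (Complex.I / 2 * m * q 2 3 0 1) at h
  have hq : -q 0 1 2 3 + q 0 2 1 3 - q 0 3 1 2 - q 1 2 0 3 + q 1 3 0 2 - q 2 3 0 1 =
      4 * obstruction (coefZ1 t) (coefZbar t) := by
    simp only [q, c, torsion20, torsion11, obstruction, Matrix.cons_val, Pi.smul_apply, smul_eq_mul,
      map_add, map_sub, map_mul, map_neg, map_one, map_zero, Complex.conj_I, Complex.conj_conj]
    ring_nf
    simp only [Complex.I_sq]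
    ring
  have h2 : 2 * Complex.I * m * obstruction (coefZ1 t) (coefZbar t) = 0 := by
    linear_combination -h - Complex.I / 2 * m * hq
  simpa [hne] using h2

end IsInvariantSKT

theorem obstruction_eq_zero_of_admitsSKT (t : admissible)
    (h : AdmitsSKT (Fin 3 → ℂ) (NakamuraManifold t)) :
    obstruction (coefZ1 t) (coefZbar t) = 0 := by
  obtain ⟨g, hg⟩ := exists_isInvariantSKT_of_admitsSKT (isUniformizing_nakChart t)
    (nakChart_target t) h
  exact hg.obstruction_eq_zero

theorem continuous_nakD : Continuous nakD := by
  unfold nakD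
  fun_prop

theorem continuous_nakDelta : Continuous nakDelta := by
  have h := continuous_nakD
  have hc : ∀ i j, Continuous fun t : Param => conj (t i j) := fun i j =>
    Complex.continuous_conj.comp (continuous_apply_apply i j)
  have hD : Continuous fun t => conj (nakD t) := Complex.continuous_conj.comp h
  have h00 := hc 0 0
  have h11 := hc 1 1
  have h10 := hc 1 0
  have h01 := hc 0 1
  unfold nakDelta
  fun_prop

theorem isOpen_admissible : IsOpen admissible := by
  have hD : Continuous fun t => conj (nakD t) := Complex.continuous_conj.comp continuous_nakD
  exact (isOpen_ne_fun continuous_nakDelta continuous_const).inter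
    (isOpen_ne_fun (continuous_const.sub (continuous_nakD.mul hD)) continuous_const)

theorem zero_mem_admissible : (0 : Param) ∈ admissible := by
  constructor <;> simp [nakDelta, nakD]

theorem continuousAt_obstruction :
    ContinuousAt (fun t : Param => obstruction (coefZ1 t) (coefZbar t)) 0 := by
  have h0 : nakDelta 0 ≠ 0 := zero_mem_admissible.1
  have h := continuous_nakDelta.continuousAt (x := (0 : Param))
  have ht : ∀ i j, ContinuousAt (fun t : Param => t i j) 0 := fun i j =>
    (continuous_apply_apply i j).continuousAt
  have hc : ∀ i j, ContinuousAt (fun t : Param => conj (t i j)) 0 := fun i j =>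
    Complex.continuous_conj.continuousAt.comp (ht i j)
  have h1 : ∀ k, ContinuousAt (fun t : Param => coefZ1 t k) 0 := by
    intro k
    fin_cases k <;> simp [coefZ1] <;> fun_prop (disch := assumption)
  have h2 : ∀ k, ContinuousAt (fun t : Param => coefZ2 t k) 0 := by
    intro k
    fin_cases k <;> simp [coefZ2] <;> fun_prop (disch := assumption)
  have hconj : ∀ {f : Param → ℂ}, ContinuousAt f 0 → ContinuousAt (fun t => conj (f t)) 0 :=
    fun hf => Complex.continuous_conj.continuousAt.comp hf
  have hsum : ∀ k, ContinuousAt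
      (fun t : Param => t 1 0 * conj (coefZ1 t k) + t 1 1 * conj (coefZ2 t k)) 0 := fun k =>
    ((ht 1 0).mul (hconj (h1 k))).add ((ht 1 1).mul (hconj (h2 k)))
  have h3 : ∀ k, ContinuousAt (fun t : Param => coefZbar t k) 0 := by
    intro k
    fin_cases k
    · exact hsum 2
    · exact hsum 3
    · exact hsum 0
    · exact hsum 1
  have hd := (h1 0).sub (h3 1)
  exact (((((h3 2).mul (hconj (h1 3))).add ((hconj (h3 2)).mul (h1 3))).sub
    ((h3 3).mul (hconj (h3 3)))).sub ((h1 2).mul (hconj (h1 2)))).sub (hd.mul (hconj hd))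

theorem exists_not_admitsSKT : ∃ ε : ℝ, 0 < ε ∧ ∀ t : Param, ‖t‖ < ε →
    ∃ ht : t ∈ admissible, ¬ AdmitsSKT (Fin 3 → ℂ) (NakamuraManifold ⟨t, ht⟩) := by
  have hne : obstruction (coefZ1 0) (coefZbar 0) ≠ 0 := by
    simp [obstruction, coefZ1, coefZbar, coefZ2, nakDelta, nakD]
  obtain ⟨ε, hε, h⟩ := Metric.eventually_nhds_iff.1
    ((isOpen_admissible.eventually_mem zero_mem_admissible).and
      (continuousAt_obstruction.eventually_ne hne))
  refine ⟨ε, hε, fun t ht => ?_⟩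
  obtain ⟨h1, h2⟩ := h (y := t) (by rwa [dist_zero_right])
  exact ⟨h1, fun hs => h2 (obstruction_eq_zero_of_admitsSKT ⟨t, h1⟩ hs)⟩

end Obstruction

/-! ### The total space of the family -/

/-- The cover `H(3; ℂ) × U` of the total space of the family, where `U` is the set of admissible
parameters. -/
def TotalCover : Type := Heis × admissible

instance : SecondCountableTopology Heis := inferInstanceAs (SecondCountableTopology (Fin 3 → ℂ))

namespace TotalCover

instance : TopologicalSpace TotalCover := inferInstanceAs (TopologicalSpace (Heis × admissible))
instance : T2Space TotalCover := inferInstanceAs (T2Space (Heis × admissible))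
instance : SecondCountableTopology TotalCover :=
  inferInstanceAs (SecondCountableTopology (Heis × admissible))

instance : LocallyCompactSpace TotalCover :=
  have : LocallyCompactSpace admissible := isOpen_admissible.locallyCompactSpace
  inferInstanceAs (LocallyCompactSpace (Heis × admissible))

instance : MulAction latticeGamma TotalCover where
  smul γ p := (γ • p.1, p.2)
  one_smul p := Prod.ext (one_smul latticeGamma p.1) rfl
  mul_smul γ δ p := Prod.ext (mul_smul γ δ p.1) rfl

theorem continuous_fst : Continuous (Prod.fst : TotalCover → Heis) := _root_.continuous_fst

theorem continuous_snd : Continuous (Prod.snd : TotalCover → admissible) := _root_.continuous_snd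

instance : ContinuousConstSMul latticeGamma TotalCover where
  continuous_const_smul γ := (continuous_fst.const_smul γ).prodMk continuous_snd

instance : IsCancelSMul latticeGamma TotalCover where
  left_cancel' γ p q h := by
    have h1 : γ • p.1 = γ • q.1 := congrArg Prod.fst h
    have h2 : (γ • p).2 = (γ • q).2 := congrArg Prod.snd h
    exact Prod.ext (smul_left_cancel γ h1) h2
  right_cancel' γ δ p h := IsCancelSMul.right_cancel γ δ p.1 (congrArg Prod.fst h)

instance : ProperlyDiscontinuousSMul latticeGamma TotalCover where
  finite_disjoint_inter_image {K L} hK hL := by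
    refine (ProperlyDiscontinuousSMul.finite_disjoint_inter_image (Γ := latticeGamma)
      (hK.image continuous_fst) (hL.image continuous_fst)).subset ?_
    rintro γ ⟨_, ⟨p, hp, rfl⟩, hL⟩
    exact ⟨_, ⟨_, ⟨p, hp, rfl⟩, rfl⟩, ⟨_, hL, rfl⟩⟩

theorem continuous_zeta : Continuous fun p : Heis × Param => nakZeta p.2 p.1 := by
  have h : ∀ i, Continuous fun p : Heis × Param => p.1 i := fun i =>
    (Heis.continuous_coord i).comp _root_.continuous_fst
  have ht : ∀ i j, Continuous fun p : Heis × Param => p.2 i j := fun i j =>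
    (continuous_apply_apply i j).comp _root_.continuous_snd
  have hc : ∀ i, Continuous fun p : Heis × Param => conj (p.1 i) := fun i =>
    Complex.continuous_conj.comp (h i)
  refine continuous_pi fun i => ?_
  fin_cases i <;> simp only [nakZeta, nakA, nakD] <;> fun_prop

theorem continuous_zetaInv :
    Continuous fun p : (Fin 3 → ℂ) × admissible => nakZetaInv p.2 p.1 := by
  have h : ∀ i, Continuous fun p : (Fin 3 → ℂ) × admissible => p.1 i := fun i =>
    (continuous_apply i).comp _root_.continuous_fst
  have ht : ∀ i j, Continuous fun p : (Fin 3 → ℂ) × admissible => (p.2 : Param) i j := fun i j =>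
    (continuous_apply_apply i j).comp (continuous_subtype_val.comp _root_.continuous_snd)
  have hconj : ∀ {f : (Fin 3 → ℂ) × admissible → ℂ}, Continuous f →
      Continuous fun p => conj (f p) := fun hf => Complex.continuous_conj.comp hf
  have hD : Continuous fun p : (Fin 3 → ℂ) × admissible => nakD p.2 :=
    continuous_nakD.comp (continuous_subtype_val.comp _root_.continuous_snd)
  have hΔ : Continuous fun p : (Fin 3 → ℂ) × admissible => nakDelta p.2 :=
    continuous_nakDelta.comp (continuous_subtype_val.comp _root_.continuous_snd)
  have h1 : ∀ p : (Fin 3 → ℂ) × admissible, nakDelta p.2 ≠ 0 := fun p => p.2.2.1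
  have h2 : ∀ p : (Fin 3 → ℂ) × admissible, 1 - nakD p.2 * conj (nakD p.2) ≠ 0 :=
    fun p => p.2.2.2
  have hcD := hconj hD
  have hcy := fun i => hconj (h i)
  have hct := fun i j => hconj (ht i j)
  have u1 := ((h 0).sub ((ht 0 0).mul (hcy 0))).sub ((ht 0 1).mul (hcy 1))
  have u2 := ((h 1).sub ((ht 1 0).mul (hcy 0))).sub ((ht 1 1).mul (hcy 1))
  have e0 : Continuous fun p : (Fin 3 → ℂ) × admissible => nakZetaInv p.2 p.1 0 :=
    ((((continuous_const.sub ((ht 1 0).mul (hct 0 1))).sub ((ht 1 1).mul (hct 1 1))).mul u1).add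
      ((((ht 0 0).mul (hct 0 1)).add ((ht 0 1).mul (hct 1 1))).mul u2)).div hΔ h1
  have e1 : Continuous fun p : (Fin 3 → ℂ) × admissible => nakZetaInv p.2 p.1 1 :=
    ((((continuous_const.sub ((ht 0 0).mul (hct 0 0))).sub ((ht 0 1).mul (hct 1 0))).mul u2).add
      ((((ht 1 0).mul (hct 0 0)).add ((ht 1 1).mul (hct 1 0))).mul u1)).div hΔ h1
  have c0 := hconj e0
  have c1 := hconj e1
  have er : Continuous fun p : (Fin 3 → ℂ) × admissible => p.1 2
      - (((p.2 : Param) 2 0 + (p.2 : Param) 1 0 * nakZetaInv p.2 p.1 0)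
        * conj (nakZetaInv p.2 p.1 0) + ((p.2 : Param) 2 1 + (p.2 : Param) 1 1
        * nakZetaInv p.2 p.1 0) * conj (nakZetaInv p.2 p.1 1))
      - nakA p.2 (nakZetaInv p.2 p.1 0) (nakZetaInv p.2 p.1 1) :=
    have hA : Continuous fun p : (Fin 3 → ℂ) × admissible =>
        nakA p.2 (nakZetaInv p.2 p.1 0) (nakZetaInv p.2 p.1 1) :=
      ((((((ht 0 0).mul (ht 1 0)).mul c0).mul c0).add
        ((((continuous_const.mul (ht 0 0)).mul (ht 1 1)).mul c0).mul c1)).add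
        ((((ht 0 1).mul (ht 1 1)).mul c1).mul c1)).div_const 2
    ((h 2).sub ((((ht 2 0).add ((ht 1 0).mul e0)).mul c0).add
      (((ht 2 1).add ((ht 1 1).mul e0)).mul c1))).sub hA
  refine Heis.continuous_mk fun i => ?_
  fin_cases i
  · exact e0
  · exact e1
  · exact (er.add (hD.mul (hconj er))).div (continuous_const.sub (hD.mul hcD)) h2

/-- The coordinates `(ζ^t, t)` on the cover of the total space. -/
def homeo : TotalCover ≃ₜ (Fin 3 → ℂ) × admissible where
  toFun p := (nakZeta p.2 p.1, p.2)
  invFun p := (nakZetaInv p.2 p.1, p.2)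
  left_inv p := Prod.ext (nakZetaInv_nakZeta p.2.2 p.1) rfl
  right_inv p := Prod.ext (nakZeta_nakZetaInv p.2.2 p.1) rfl
  continuous_toFun := (continuous_zeta.comp
    (continuous_fst.prodMk (continuous_subtype_val.comp continuous_snd))).prodMk continuous_snd
  continuous_invFun := continuous_zetaInv.prodMk _root_.continuous_snd

instance : Nonempty TotalCover := ⟨(1, ⟨0, zero_mem_admissible⟩)⟩

theorem isOpenEmbedding_coord :
    Topology.IsOpenEmbedding fun p : TotalCover => ((nakZeta p.2 p.1, p.2) : (Fin 3 → ℂ) × Param) :=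
  (Topology.IsOpenEmbedding.id.prodMap isOpen_admissible.isOpenEmbedding_subtypeVal).comp
    homeo.isOpenEmbedding

/-- The global chart `(ζ^t, t)` of the cover of the total space. -/
def chart : OpenPartialHomeomorph TotalCover ((Fin 3 → ℂ) × Param) :=
  isOpenEmbedding_coord.toOpenPartialHomeomorph _

instance : ChartedSpace ((Fin 3 → ℂ) × Param) TotalCover := chart.singletonChartedSpace rfl

theorem chart_symm_apply (y : Fin 3 → ℂ) (t : admissible) :
    chart.symm (y, (t : Param)) = (nakZetaInv t y, t) := by
  have h : chart ((nakZetaInv t y, t) : Heis × admissible) = (y, (t : Param)) :=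
    Prod.ext (nakZeta_nakZetaInv t.2 y) rfl
  rw [← h]
  exact chart.left_inv trivial

theorem mem_chart_target {p : (Fin 3 → ℂ) × Param} : p ∈ chart.target ↔ p.2 ∈ admissible := by
  constructor
  · intro hp
    rw [← chart.right_inv hp]
    exact (chart.symm p).2.2
  · intro hp
    have h : chart ((nakZetaInv p.2 p.1, ⟨p.2, hp⟩) : Heis × admissible) = p :=
      Prod.ext (nakZeta_nakZetaInv hp p.1) rfl
    rw [← h]
    exact chart.map_source trivial

theorem deck_chart (γ : latticeGamma) {p : (Fin 3 → ℂ) × Param} (hp : p ∈ chart.target) :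
    deck chart γ p = (nakLeft p.2 γ p.1, p.2) := by
  rw [mem_chart_target] at hp
  have h := chart_symm_apply p.1 ⟨p.2, hp⟩
  change chart.symm p = _ at h
  rw [deck, h]
  refine Prod.ext ?_ rfl
  change nakZeta p.2 ((γ : Heis) * nakZetaInv p.2 p.1) = _
  rw [nakZeta_mul_eq_nakLeft, nakZeta_nakZetaInv hp]

/-- The left multiplications are holomorphic also in the parameter `t`, in the coordinates `ζ^t`. -/
theorem contDiff_nakLeft_param (w : Heis) :
    ContDiff ℂ ω fun p : (Fin 3 → ℂ) × Param => nakLeft p.2 w p.1 := by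
  have h : ∀ i, ContDiff ℂ ω fun p : (Fin 3 → ℂ) × Param => p.1 i := fun i =>
    (contDiff_apply ℂ ℂ i).comp contDiff_fst
  have ht : ∀ i j, ContDiff ℂ ω fun p : (Fin 3 → ℂ) × Param => p.2 i j := fun i j =>
    (contDiff_apply_apply ℂ ℂ i j).comp contDiff_snd
  refine contDiff_pi.2 fun i => ?_
  fin_cases i <;> simp [nakLeft, nakShift, nakA, nakD, div_eq_mul_inv] <;> fun_prop

theorem isUniformizing_chart : IsUniformizing latticeGamma chart where
  source_eq := rfl
  chartAt_eq _ := rfl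
  contDiffOn_deck γ := ((contDiff_nakLeft_param γ).prodMk contDiff_snd).contDiffOn.congr
    fun _ hp => deck_chart γ hp

end TotalCover

/-- The total space of the family. -/
abbrev TotalSpace : Type := MulAction.orbitRel.Quotient latticeGamma TotalCover

namespace TotalSpace

/-- The projection of the total space onto the parameters. -/
def proj : TotalSpace → Param := Quotient.lift (fun p : TotalCover => (p.2 : Param)) (by
  rintro _ p ⟨γ, rfl⟩
  rfl)

theorem proj_unif {p : (Fin 3 → ℂ) × Param} (hp : p ∈ TotalCover.chart.target) :
    proj (unif latticeGamma TotalCover.chart p) = p.2 :=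
  congrArg Prod.snd (TotalCover.chart.right_inv hp)

theorem contMDiff_proj : ContMDiff 𝓘(ℂ, (Fin 3 → ℂ) × Param) 𝓘(ℂ, Param) ω proj := by
  refine TotalCover.isUniformizing_chart.contMDiff_of_comp_unif fun p hp => ?_
  refine contDiff_snd.contDiffAt.contMDiffAt.congr_of_eventuallyEq ?_
  filter_upwards [TotalCover.chart.open_target.mem_nhds hp] with q hq
  exact proj_unif hq

theorem surjective_mfderiv_proj (x : TotalSpace) :
    Function.Surjective (mfderiv 𝓘(ℂ, (Fin 3 → ℂ) × Param) 𝓘(ℂ, Param) proj x) := by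
  obtain ⟨p, hp, rfl⟩ := TotalCover.isUniformizing_chart.unif_surjective x
  have h : mfderiv 𝓘(ℂ, (Fin 3 → ℂ) × Param) 𝓘(ℂ, Param)
      (proj ∘ unif latticeGamma TotalCover.chart) p =
      ContinuousLinearMap.snd ℂ (Fin 3 → ℂ) Param := by
    have : proj ∘ unif latticeGamma TotalCover.chart =ᶠ[𝓝 p] Prod.snd := by
      filter_upwards [TotalCover.chart.open_target.mem_nhds hp] with q hq
      exact proj_unif hq
    rw [this.mfderiv_eq, mfderiv_eq_fderiv]
    exact fderiv_snd
  rw [mfderiv_comp p (contMDiff_proj.mdifferentiable (by simp) _)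
    ((TotalCover.isUniformizing_chart.contMDiffAt_unif hp).mdifferentiableAt (by simp))] at h
  intro v
  exact ⟨_, DFunLike.congr_fun h ((0, v) : (Fin 3 → ℂ) × Param)⟩

theorem range_proj : Set.range proj = admissible := by
  ext t
  constructor
  · rintro ⟨x, rfl⟩
    obtain ⟨p, rfl⟩ := Quotient.exists_rep x
    exact p.2.2
  · intro ht
    exact ⟨Quotient.mk _ ((1, ⟨t, ht⟩) : Heis × admissible), rfl⟩

/-- The preimage is the image of a compact subset of the cover, because every point of `H(3; ℂ)` can
be moved to the unit cell by the lattice. -/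
theorem isCompact_preimage_proj {K : Set Param} (hK : K ⊆ admissible) (hc : IsCompact K) :
    IsCompact (proj ⁻¹' K) := by
  have h1 : IsCompact ((↑) ⁻¹' K : Set admissible) :=
    (Topology.IsInducing.subtypeVal.isCompact_preimage_iff (by simpa using hK)).2 hc
  have h2 : IsCompact (closedCell ×ˢ ((↑) ⁻¹' K : Set admissible)) := isCompact_closedCell.prod h1
  have h3 : Continuous (Quotient.mk _ : TotalCover → TotalSpace) := continuous_quotient_mk'
  convert h2.image h3 using 1
  ext x
  constructor
  · intro hx
    obtain ⟨p, rfl⟩ := Quotient.exists_rep x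
    obtain ⟨γ, hγ, -⟩ := existsUnique_mem_unitCell p.1
    exact ⟨γ • p, ⟨unitCell_subset hγ, hx⟩, IsUniformizing.mk_smul γ p⟩
  · rintro ⟨p, hp, rfl⟩
    exact hp.2

variable (t : admissible)

/-- The inclusion of `M_t` into the total space. -/
def incl : NakamuraManifold t → TotalSpace :=
  Quotient.map (fun z : NakCover t => ((z, t) : Heis × admissible)) (by
    rintro _ z ⟨γ, rfl⟩
    exact ⟨γ, rfl⟩)

theorem incl_comp_unif : incl t ∘ unif latticeGamma (nakChart t) =
    unif latticeGamma TotalCover.chart ∘ fun y => (y, (t : Param)) := by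
  funext y
  rw [Function.comp_apply, Function.comp_apply, unif, unif, TotalCover.chart_symm_apply]
  rfl

theorem mk_mem_target (y : Fin 3 → ℂ) : (y, (t : Param)) ∈ TotalCover.chart.target :=
  TotalCover.mem_chart_target.2 t.2

theorem contMDiffAt_unif_mk (y : Fin 3 → ℂ) :
    ContMDiffAt 𝓘(ℂ, (Fin 3 → ℂ) × Param) 𝓘(ℂ, (Fin 3 → ℂ) × Param) ω
      (unif latticeGamma TotalCover.chart) (y, (t : Param)) :=
  TotalCover.isUniformizing_chart.contMDiffAt_unif (mk_mem_target t y)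

theorem contMDiff_incl :
    ContMDiff 𝓘(ℂ, Fin 3 → ℂ) 𝓘(ℂ, (Fin 3 → ℂ) × Param) ω (incl t) := by
  refine (isUniformizing_nakChart t).contMDiff_of_comp_unif fun y _ => ?_
  rw [incl_comp_unif]
  exact (contMDiffAt_unif_mk t y).comp y (contDiff_prodMk_left _).contDiffAt.contMDiffAt

theorem injective_incl : Function.Injective (incl t) := by
  intro x y h
  obtain ⟨z, rfl⟩ := Quotient.exists_rep x
  obtain ⟨w, rfl⟩ := Quotient.exists_rep y
  obtain ⟨γ, hγ⟩ := Quotient.exact h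
  exact Quotient.sound ⟨γ, congrArg Prod.fst hγ⟩

theorem injective_mfderiv_incl (x : NakamuraManifold t) :
    Function.Injective (mfderiv 𝓘(ℂ, Fin 3 → ℂ) 𝓘(ℂ, (Fin 3 → ℂ) × Param) (incl t) x) := by
  obtain ⟨y, hy, rfl⟩ := (isUniformizing_nakChart t).unif_surjective x
  have hs : HasFDerivAt (fun y : Fin 3 → ℂ => (y, (t : Param)))
      (ContinuousLinearMap.inl ℂ (Fin 3 → ℂ) Param) y := hasFDerivAt_prodMk_left _ _
  have hR := ((contMDiffAt_unif_mk t y).mdifferentiableAt (by simp)).hasMFDerivAt.comp y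
    hs.hasMFDerivAt
  have hL := ((contMDiff_incl t).mdifferentiable (by simp) _).hasMFDerivAt.comp y
    (((isUniformizing_nakChart t).contMDiffAt_unif hy).mdifferentiableAt (by simp)).hasMFDerivAt
  have h := hasMFDerivAt_unique hL (hR.congr_of_eventuallyEq
    (Filter.Eventually.of_forall (congrFun (incl_comp_unif t))))
  have hinj := TotalCover.isUniformizing_chart.injective_mfderiv_unif (mk_mem_target t y)
  intro v w hvw
  obtain ⟨v, rfl⟩ := (isUniformizing_nakChart t).surjective_mfderiv_unif hy v
  obtain ⟨w, rfl⟩ := (isUniformizing_nakChart t).surjective_mfderiv_unif hy w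
  have hv := DFunLike.congr_fun h v
  have hw := DFunLike.congr_fun h w
  have h2 := hinj ((hv.symm.trans hvw).trans hw)
  have h3 : v = w := congrArg Prod.fst h2
  rw [h3]

theorem range_incl : Set.range (incl t) = proj ⁻¹' {(t : Param)} := by
  ext x
  constructor
  · rintro ⟨y, rfl⟩
    obtain ⟨z, rfl⟩ := Quotient.exists_rep y
    rfl
  · intro hx
    obtain ⟨p, rfl⟩ := Quotient.exists_rep x
    exact ⟨Quotient.mk _ (p.1 : NakCover t),
      congrArg (Quotient.mk _) (Prod.ext rfl (Subtype.ext hx.symm))⟩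

end TotalSpace

theorem compactSpace_nakamuraManifold (t : admissible) : CompactSpace (NakamuraManifold t) := by
  have h : Continuous (Quotient.mk _ : NakCover t → NakamuraManifold t) := continuous_quotient_mk'
  have h2 : IsCompact (closedCell : Set (NakCover t)) := isCompact_closedCell
  refine ⟨?_⟩
  convert h2.image h using 1
  refine (Set.eq_univ_of_forall fun x => ?_).symm
  obtain ⟨z, rfl⟩ := Quotient.exists_rep x
  obtain ⟨γ, hγ, -⟩ := existsUnique_mem_unitCell z
  exact ⟨γ • z, unitCell_subset hγ, IsUniformizing.mk_smul γ z⟩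

theorem isHolomorphicFamily_nakamuraManifold :
    IsHolomorphicFamily (Fin 3 → ℂ) admissible NakamuraManifold :=
  ⟨isOpen_admissible,
    fun t => ⟨compactSpace_nakamuraManifold t, inferInstance,
      (isUniformizing_nakChart t).isManifold⟩,
    TotalSpace, inferInstance, inferInstance, TotalSpace.proj, inferInstance,
    ContinuousConstSMul.secondCountableTopology, TotalCover.isUniformizing_chart.isManifold,
    TotalSpace.contMDiff_proj, TotalSpace.range_proj,
    fun _ hK hc => TotalSpace.isCompact_preimage_proj hK hc,
    TotalSpace.surjective_mfderiv_proj, fun t => ⟨TotalSpace.incl t, TotalSpace.contMDiff_incl t,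
      TotalSpace.injective_incl t, TotalSpace.injective_mfderiv_incl t, TotalSpace.range_incl t⟩⟩

/-! ### The central fibre -/

theorem nakHomeo_zero : (nakHomeo ⟨0, zero_mem_admissible⟩ : Heis → Fin 3 → ℂ) = id := by
  funext z i
  change nakZeta 0 z i = z i
  fin_cases i <;> simp [nakZeta, nakA, nakD]

/-- The chart of `H(3; ℂ) = ℂ³`. -/
def heisChart : OpenPartialHomeomorph Heis (Fin 3 → ℂ) := OpenPartialHomeomorph.refl (Fin 3 → ℂ)

theorem heisChart_eq : heisChart = nakChart ⟨0, zero_mem_admissible⟩ := by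
  refine OpenPartialHomeomorph.ext _ _ (fun z => (congrFun nakHomeo_zero z).symm) (fun y => ?_) rfl
  have h := nakZetaInv_nakZeta zero_mem_admissible y
  change nakZetaInv 0 (nakHomeo ⟨0, zero_mem_admissible⟩ y) = y at h
  rw [nakHomeo_zero] at h
  exact h.symm

theorem unif_heisChart :
    unif latticeGamma heisChart = unif latticeGamma (nakChart ⟨0, zero_mem_admissible⟩) := by
  rw [heisChart_eq]
  rfl

theorem isUniformizing_heisChart : IsUniformizing latticeGamma heisChart where
  source_eq := rfl
  chartAt_eq _ := rfl
  contDiffOn_deck γ := by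
    have h := (isUniformizing_nakChart ⟨0, zero_mem_admissible⟩).contDiffOn_deck γ
    rw [heisChart_eq]
    exact h

/-- `M_0` and the Iwasawa manifold have the same underlying space and the same uniformization. -/
def iwasawaDiffeomorph : IwasawaManifold
    ≃ₘ^ω⟮𝓘(ℂ, Fin 3 → ℂ), 𝓘(ℂ, Fin 3 → ℂ)⟯ NakamuraManifold ⟨0, zero_mem_admissible⟩ where
  toEquiv := Equiv.refl IwasawaManifold
  contMDiff_toFun := by
    refine isUniformizing_heisChart.contMDiff_of_comp_unif fun y _ => ?_
    have h := (isUniformizing_nakChart ⟨0, zero_mem_admissible⟩).contMDiffAt_unif (y := y) trivial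
    rw [← unif_heisChart] at h
    exact h
  contMDiff_invFun := by
    refine (isUniformizing_nakChart _).contMDiff_of_comp_unif fun y _ => ?_
    have h := isUniformizing_heisChart.contMDiffAt_unif (y := y) trivial
    rw [unif_heisChart] at h
    exact h

end

theorem theorem1p2 :
    -- the deformations `M_t` are a holomorphic family with central fibre the Iwasawa manifold
    IsHolomorphicFamily (Fin 3 → ℂ) admissible NakamuraManifold ∧
    (∃ h0 : (0 : Param) ∈ admissible,
      Nonempty (IwasawaManifold ≃ₘ^ω⟮𝓘(ℂ, Fin 3 → ℂ), 𝓘(ℂ, Fin 3 → ℂ)⟯ NakamuraManifold ⟨0, h0⟩)) ∧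
    -- its sufficiently small members do not admit any SKT metric
    (∃ ε : ℝ, 0 < ε ∧ ∀ t : Param, ‖t‖ < ε →
      ∃ ht : t ∈ admissible, ¬ AdmitsSKT (Fin 3 → ℂ) (NakamuraManifold ⟨t, ht⟩)) ∧
    -- the sub-family connects the central fibre to the first circle
    (∀ t ∈ subFamily, ‖t 1 0‖ ^ 2 = 2 - √3 →
      segment ℝ 0 t ⊆ subFamily ∩ admissible ∧
      ∃ ht : t ∈ admissible, AdmitsSKT (Fin 3 → ℂ) (NakamuraManifold ⟨t, ht⟩)) ∧
    -- the second circle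
    (∀ t ∈ subFamily, ‖t 1 0‖ ^ 2 = 2 + √3 →
      ∃ ht : t ∈ admissible, AdmitsSKT (Fin 3 → ℂ) (NakamuraManifold ⟨t, ht⟩)) :=
  ⟨isHolomorphicFamily_nakamuraManifold, ⟨zero_mem_admissible, ⟨iwasawaDiffeomorph⟩⟩,
    exists_not_admitsSKT, fun _ ht h => first_circle ht h, fun _ ht h => second_circle ht h⟩
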